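/- Let $I=[1:i:0]$ and $J=[1:-i:0]$ be the cyclic points of $\mathbb P^2=\mathbb P^2(\mathbb C)$, let $\mathcal C=V(F)\subset\mathbb P^2$ be an irreducible algebraic curve of degree $d\ge 2$, and let $S\in\mathbb P^2\setminus\{I,J\}$. We fix representatives $\mathbf I=(1,i,0)$, $\mathbf J=(1,-i,0)$ and $\mathbf S$ in $\mathbb C^3\setminus\{0\}$. Let $m_1\in\mathcal C$ and let $\mathcal B_0$ be a branch of $\mathcal C$ at $m_1$, with tangent line $T=\mathcal T_{m_1}\mathcal B_0$. **Local contribution.** Let $M\in GL_3(\mathbb C)$ map $(0,0,1)$ to a representative of $m_1$ and be such that the branch $\mathcal B=M^{-1}(\mathcal B_0)$ of $V(F\circ M)$ at $[0:0:1]$ is not tangent to the line $x=0$. By Puiseux, $\mathcal B$ is given in the chart $z=1$ by a primitive parametrization $x=t^{e}$, $y=\varphi(t)$, where $\varphi$ is a power series of order at least $e$ and $e=e_{\mathcal B_0}$ is the multiplicity of the branch. So it consists of the $e$ pro-branches $y=g_k(x):=\varphi(\zeta^kx^{1/e})$, $0\le k<e$, $\zeta=e^{2i\pi/e}$. Let $\mathrm{val}$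 be the $x$-adic valuation of Puiseux series in $x$. For a homogeneous polynomial $G$, the intersection number of $\mathcal B_0$ with $V(G)$ at $m_1$ is $i_{m_1}(\mathcal B_0,V(G))=\sum_k \mathrm{val}\big(G(M(x,g_k(x),1))\big)\in[0,\infty]$. Put $\mathbf A=M^{-1}\mathbf I$, $\mathbf B=M^{-1}\mathbf J$, $\mathbf S'=M^{-1}\mathbf S$ and, for $\mathbf P=(x_P,y_P,z_P)$, $$W_{\mathbf P,k}(x)=y_P-g_k'(x)x_P+z_P\,(xg_k'(x)-g_k(x)),$$ $$\hat R_k(x)=(x,g_k(x),1)\wedge\big[W_{\mathbf A,k}W_{\mathbf B,k}\,\mathbf S'-W_{\mathbf S',k}W_{\mathbf A,k}\,\mathbf B-W_{\mathbf S',k}W_{\mathbf B,k}\,\mathbf A\big],$$ where $\wedge$ is the cross product of $\mathbb C^3$. The local contribution of $\mathcal B_0$ is $$h_{m_1,\mathcal B_0}=\sum_{k=0}^{e-1}\ \min_{j=1,2,3}\mathrm{val}\big([\hat R_k]_j\big).$$ **Lemma.** Write $e=e_{\mathcal B_0}$, $\iota=i_{m_1}(\mathcal B_0,T)$ and $h=h_{m_1,\mathcal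 B_0}$. For every $M$ as above, $\iota$ and $h$ are finite non-negative integers, and: 1. $h=0$ if $I,J,S\notin T$. 2. $h=0$ if $\#(T\cap\{I,J,S\})=1$ and $m_1\notin\{I,J,S\}$. 3. $h=e$ if $\#(T\cap\{I,J,S\})=1$ and $m_1\in\{I,J,S\}$. 4. $h=\iota+\min(\iota-2e,0)$ if $T=(IS)$, $J\notin T$ and $m_1\notin\{I,S\}$, and also if $T=(JS)$, $I\notin T$ and $m_1\notin\{J,S\}$. 5. $h=\iota$ if $T=(IS)$, $J\notin T$ and $m_1\in\{I,S\}$, and also if $T=(JS)$, $I\notin T$ and $m_1\in\{J,S\}$. 6. $h=\iota-e$ if $T=(IJ)$, $S\notin T$ and $m_1\notin\{I,J\}$. 7. $h=\iota$ if $T=(IJ)$, $S\notin T$ and $m_1\in\{I,J\}$. 8. $h=2\iota-2e$ if $I,J,S\in T$ and $m_1\notin\{I,J,S\}$. 9. $h=2\iota-e$ if $I,J,S\in T$ and $m_1\in\{I,J\}$. 10. $h=2\iota-e$ if $I,J,S\in T$, $m_1=S$ and $\iota\ne 2e$. 11. $h=e\,(1+\min(\beta_1,3))$ if $I,J,S\in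 T$, $m_1=S$ and $\iota=2e$, where $e\beta_1=i_{m_1}(\mathcal B_0,\mathcal C')\in(2e,\infty]$ for any osculating curve $\mathcal C'$ of $\mathcal B_0$ at $m_1$, i.e. any algebraic curve $\mathcal C'$ that is smooth at $m_1$ and satisfies $i_{m_1}(\mathcal B_0,\mathcal C')>2e$ (such curves exist). The same formula holds if $e\beta_1$ is replaced by the first characteristic exponent of $\mathcal B_0$ that is not a multiple of $e$, i.e. the least exponent of $\varphi(t)$ not divisible by $e$ ($\infty$ if there is none). -/

import Mathlib

noncomputable section

namespace Caustic

/-- The complex projective plane. -/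
abbrev P2 : Type := Projectivization ℂ (Fin 3 → ℂ)

/-- The vector `(1, i, 0)`. -/
def vecI : Fin 3 → ℂ := ![1, Complex.I, 0]

/-- The vector `(1, -i, 0)`. -/
def vecJ : Fin 3 → ℂ := ![1, -Complex.I, 0]

theorem vecI_ne_zero : vecI ≠ 0 := fun h => by
  have := congrFun h 0
  simp [vecI] at this

theorem vecJ_ne_zero : vecJ ≠ 0 := fun h => by
  have := congrFun h 0
  simp [vecJ] at this

/-- The cyclic point `I = [1 : i : 0]`. -/
def ptI : P2 := Projectivization.mk ℂ vecI vecI_ne_zero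

/-- The cyclic point `J = [1 : -i : 0]`. -/
def ptJ : P2 := Projectivization.mk ℂ vecJ vecJ_ne_zero

/-- The line through two distinct points of the plane. -/
def lineThrough (P Q : P2) : Set P2 := {R | R.submodule ≤ P.submodule ⊔ Q.submodule}

/-- The zero locus `V(G)` of a homogeneous polynomial `G`. -/
def zeroLocus (G : MvPolynomial (Fin 3) ℂ) : Set P2 :=
  {P | MvPolynomial.eval P.rep G = 0}

/-- The curve `V(G)` passes through `P` and is nonsingular there. -/
def IsSmoothAt (G : MvPolynomial (Fin 3) ℂ) (P : P2) : Prop :=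
  P ∈ zeroLocus G ∧ ∃ k, MvPolynomial.eval P.rep (MvPolynomial.pderiv k G) ≠ 0

/-- The point `Π(M(P₀))`, where `P₀ = (0, 0, 1)`. -/
def frameCenter (M : GL (Fin 3) ℂ) : P2 :=
  Projectivization.mk ℂ ((M : Matrix (Fin 3) (Fin 3) ℂ).mulVec ![0, 0, 1]) (fun h => by
    have h2 : ((M⁻¹ : GL (Fin 3) ℂ) : Matrix (Fin 3) (Fin 3) ℂ).mulVec
        ((M : Matrix (Fin 3) (Fin 3) ℂ).mulVec ![0, 0, 1]) = ![0, 0, 1] := by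
      rw [Matrix.mulVec_mulVec, ← Units.val_mul, inv_mul_cancel, Units.val_one,
        Matrix.one_mulVec]
    rw [h, Matrix.mulVec_zero] at h2
    have := congrFun h2 2
    simp at this)

/-- The image `M v` of a vector `v` with entries in a `ℂ`-algebra. -/
def applyFrame {A : Type} [CommRing A] [Algebra ℂ A] (M : GL (Fin 3) ℂ) (v : Fin 3 → A) :
    Fin 3 → A :=
  fun k => ∑ j, (M : Matrix (Fin 3) (Fin 3) ℂ) k j • v j

/-- Coordinates in the frame `M`: the vector `M⁻¹ v`. -/
def pullVec (M : GL (Fin 3) ℂ) (v : Fin 3 → ℂ) : Fin 3 → ℂ :=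
  ((M⁻¹ : GL (Fin 3) ℂ) : Matrix (Fin 3) (Fin 3) ℂ).mulVec v

/-! Puiseux series, inside the field of Hahn series `∑ a_q x ^ q` with rational exponents. The
valuation `val` is `HahnSeries.orderTop`, with values in `WithTop ℚ`. -/

/-- The substitution `t ↦ x ^ (1 / e)`, from power series in `t` to Puiseux series in `x`. -/
def puiseux (e : ℕ) (he : 0 < e) : PowerSeries ℂ →+* HahnSeries ℚ ℂ :=
  (HahnSeries.embDomainRingHom
    ((AddMonoidHom.mulRight ((e : ℚ)⁻¹)).comp (Nat.castAddMonoidHom ℚ))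
    (fun a b h => by
      have he' : (e : ℚ)⁻¹ ≠ 0 := inv_ne_zero (Nat.cast_ne_zero.mpr he.ne')
      exact Nat.cast_injective (mul_right_cancel₀ he' h))
    (fun a b => by
      have he' : 0 < (e : ℚ)⁻¹ := inv_pos.mpr (Nat.cast_pos.mpr he)
      exact (mul_le_mul_iff_left₀ he').trans Nat.cast_le)).comp
    (HahnSeries.toPowerSeries (R := ℂ)).symm.toRingHom

/-- The derivative with respect to `x` of a series `∑ a_q x ^ q`. -/
def dx (f : HahnSeries ℚ ℂ) : HahnSeries ℚ ℂ where
  coeff q := ((q + 1 : ℚ) : ℂ) * f.coeff (q + 1)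
  isPWO_support' := by
    refine (f.isPWO_support.image_of_monotone (f := fun q : ℚ => q - 1)
      (fun a b h => sub_le_sub_right h 1)).mono ?_
    intro q hq
    refine ⟨q + 1, ?_, by simp⟩
    intro h0
    apply hq
    simp only at h0 ⊢
    rw [h0, mul_zero]

/-- The series `x`. -/
def seriesX : HahnSeries ℚ ℂ := HahnSeries.single 1 1

/-- A branch at `P₀` of the curve `V(F ∘ M)` that is not tangent to the line `V(x)`, given in the
chart `z = 1` by a Puiseux parametrization `x = t ^ e`, `y = h(t)`, with `h` of order at least `e`,
which is not a parametrization in a power `t ^ k`, `k > 1`. Its image under `M` is a branch of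
`V(F)` at the point `frameCenter M`. -/
structure Branch (F : MvPolynomial (Fin 3) ℂ) (M : GL (Fin 3) ℂ) where
  /-- The multiplicity of the branch, which is its number of pro-branches. -/
  e : ℕ
  e_pos : 0 < e
  /-- The series `h`. -/
  h : PowerSeries ℂ
  coeff_eq_zero : ∀ n < e, PowerSeries.coeff n h = 0
  primitive : ∀ k : ℕ, k ∣ e → (∀ n, PowerSeries.coeff n h ≠ 0 → k ∣ n) → k = 1
  on_curve :
    MvPolynomial.aeval (applyFrame M ![(PowerSeries.X : PowerSeries ℂ) ^ e, h, 1]) F = 0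

namespace Branch

variable {F : MvPolynomial (Fin 3) ℂ} {M : GL (Fin 3) ℂ} (B : Branch F M)

/-- The pro-branches `g_i(x) = h(ζ ^ i x ^ (1 / e))`, `ζ = exp (2 π i / e)`, `0 ≤ i < e`. -/
def g (i : Fin B.e) : HahnSeries ℚ ℂ :=
  puiseux B.e B.e_pos
    (PowerSeries.rescale (Complex.exp (2 * Real.pi * Complex.I / B.e) ^ (i : ℕ)) B.h)

/-- The intersection number at `frameCenter M` of the branch `M(B)` with the curve `V(G)`: the sum
of the valuations of `G ∘ M (x, g_i(x), 1)`. -/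
def inter (G : MvPolynomial (Fin 3) ℂ) : WithTop ℚ :=
  ∑ i, (MvPolynomial.aeval (applyFrame M ![seriesX, B.g i, 1]) G).orderTop

/-- The linear form that defines the tangent line of `M(B)`: the form `y - a x` in the coordinates
`(x, y, z)` of the frame `M`, where `a` is the common slope of the pro-branches at `x = 0`. -/
def tangentForm : MvPolynomial (Fin 3) ℂ :=
  ∑ k, MvPolynomial.C
      (((M⁻¹ : GL (Fin 3) ℂ) : Matrix (Fin 3) (Fin 3) ℂ) 1 k -
        PowerSeries.coeff B.e B.h * ((M⁻¹ : GL (Fin 3) ℂ) : Matrix (Fin 3) (Fin 3) ℂ) 0 k) *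
    MvPolynomial.X k

/-- The tangent line of the branch `M(B)`. -/
def tangentLine : Set P2 := zeroLocus B.tangentForm

/-- `W_{P,i}(x) = y_P - g_i'(x) x_P + z_P (x g_i'(x) - g_i(x))`. -/
def W (P : Fin 3 → ℂ) (i : Fin B.e) : HahnSeries ℚ ℂ :=
  HahnSeries.C (P 1) - dx (B.g i) * HahnSeries.C (P 0) +
    HahnSeries.C (P 2) * (seriesX * dx (B.g i) - B.g i)

/-- The vector `(x, g_i, 1) ∧ [W_A W_B S' - W_{S'} W_A B - W_{S'} W_B A]`, where `A`, `B`, `S'` are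
the coordinate vectors of `I`, `J`, `S` in the frame `M`. -/
def Rhat (s : Fin 3 → ℂ) (i : Fin B.e) : Fin 3 → HahnSeries ℚ ℂ :=
  crossProduct ![seriesX, B.g i, 1] (fun k =>
    B.W (pullVec M vecI) i * B.W (pullVec M vecJ) i * HahnSeries.C (pullVec M s k)
      - B.W (pullVec M s) i * B.W (pullVec M vecI) i * HahnSeries.C (pullVec M vecJ k)
      - B.W (pullVec M s) i * B.W (pullVec M vecJ) i * HahnSeries.C (pullVec M vecI k))

/-- The contribution of the `i`-th pro-branch: the least valuation of a coordinate of `Rhat`. -/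
def proContribution (s : Fin 3 → ℂ) (i : Fin B.e) : WithTop ℚ :=
  Finset.univ.inf fun j => (B.Rhat s i j).orderTop

/-- The local contribution of the branch `M(B)`: the sum over its pro-branches. -/
def contribution (s : Fin 3 → ℂ) : WithTop ℚ := ∑ i, B.proContribution s i

/-- An osculating smooth curve to `M(B)`: a curve `V(G)` that is nonsingular at the center of the
branch and meets the branch there with intersection number greater than `2 e`. -/
def IsOsculating (G : MvPolynomial (Fin 3) ℂ) : Prop :=
  (∃ k, G.IsHomogeneous k) ∧ IsSmoothAt G (frameCenter M) ∧
    (2 : WithTop ℚ) * (B.e : WithTop ℚ) < B.inter G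

open Classical in
/-- The first characteristic exponent that is not a multiple of `e`: the least exponent `n` of `h`
that is not divisible by `e`, and `⊤` if there is none. -/
def firstCharExp : WithTop ℚ :=
  if H : ∃ n : ℕ, PowerSeries.coeff n B.h ≠ 0 ∧ ¬ B.e ∣ n then
    ((Nat.find H : ℚ) : WithTop ℚ) else ⊤

end Branch

end Caustic

end

noncomputable section

namespace Caustic

open PowerSeries

/-! ### Puiseux substitution -/

/-! Every pro-branch is the image of one parametrization `(t^e, h, 1)` under a substitution `t ↦ ζ^i
x^(1/e)`, which divides orders by `e`. Summing over the `e` pro-branches turns the contribution and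
the intersection numbers into orders in `t` (`Branch.contribution_eq`, `Branch.inter_eq`).

Shear the frame so that the tangent is `y = 0`. Since `F` is irreducible of degree at least 2, the
branch is not a line, so `h = a t^e + t^(k+e) η` with `η(0) ≠ 0`, and `dy/dx = a + t^k δ` with `e
δ(0) = (k+e) η(0)`; here `ι = k + e` (`Branch.exists_normal_form`). The wedge with the
parametrization has two essential components, and its order is the minimum of the orders of `rRed`
and of `W_A W_B W_S` (`inf_order_cross`, `Branch.contribution_eq_redOrder`).

The series `W_P` has order `0` if `P` is off the tangent, `k` if `P` is on it away from the center,
and `k + e` if `P` is the center. Each case is then a comparison of leading terms (`min_order_eq`),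
whose coefficients are nonzero by the relation between `δ(0)` and `η(0)`.

The delicate case has all three points on the tangent and `S` at the center. The leading coefficient
of `rRed` contains `δ(0) - 2η(0)`, which vanishes exactly when `k = e`, that is `ι = 2e`. The order
of `δ - 2η` then decides, until `W_A W_B W_S` caps it. It equals the order of `η - η(0)`, which is
also what an osculating curve and the first characteristic exponent measure below `3e`. -/

theorem puiseux_apply (e : ℕ) (he : 0 < e) :
    ∃ φ : ℕ ↪o ℚ, (∀ n, φ n = n * (e : ℚ)⁻¹) ∧
      ∀ f, puiseux e he f = HahnSeries.embDomain φ (HahnSeries.toPowerSeries.symm f) :=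
  ⟨_, fun _ => rfl, fun _ => rfl⟩

theorem puiseux_coeff (e : ℕ) (he : 0 < e) (f : PowerSeries ℂ) (n : ℕ) :
    (puiseux e he f).coeff (n * (e : ℚ)⁻¹) = coeff n f := by
  obtain ⟨φ, h1, h2⟩ := puiseux_apply e he
  rw [h2, ← h1, HahnSeries.embDomain_coeff, HahnSeries.coeff_toPowerSeries_symm]

theorem puiseux_coeff_eq_zero (e : ℕ) (he : 0 < e) (f : PowerSeries ℂ) {q : ℚ}
    (hq : ∀ n : ℕ, coeff n f ≠ 0 → q ≠ n * (e : ℚ)⁻¹) : (puiseux e he f).coeff q = 0 := by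
  obtain ⟨φ, h1, h2⟩ := puiseux_apply e he
  rw [h2]
  apply HahnSeries.embDomain_notin_image_support
  rintro ⟨n, hn, rfl⟩
  exact hq n hn (h1 n)

theorem puiseux_C (e : ℕ) (he : 0 < e) (c : ℂ) : puiseux e he (C c) = HahnSeries.C c := by
  ext q
  by_cases hq : q = 0
  · subst hq
    have := puiseux_coeff e he (C c) 0
    simpa using this
  · rw [puiseux_coeff_eq_zero, HahnSeries.C_apply, HahnSeries.coeff_single_of_ne hq]
    rintro n hn rfl
    rw [coeff_C] at hn
    split_ifs at hn with h0
    · simp [h0] at hq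
    · exact hn rfl

theorem puiseux_X_pow (e : ℕ) (he : 0 < e) : puiseux e he (X ^ e) = seriesX := by
  have he' : (e : ℚ) ≠ 0 := Nat.cast_ne_zero.mpr he.ne'
  ext q
  by_cases hq : q = 1
  · subst hq
    have := puiseux_coeff e he (X ^ e) e
    rw [mul_inv_cancel₀ he'] at this
    rw [this]
    simp [seriesX]
  · rw [puiseux_coeff_eq_zero, seriesX, HahnSeries.coeff_single_of_ne hq]
    rintro n hn rfl
    rw [coeff_X_pow] at hn
    split_ifs at hn with h0
    · subst h0
      exact hq (mul_inv_cancel₀ he')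
    · exact hn rfl

/-- The inclusion of the extended naturals in `WithTop ℚ`. -/
def toRat (n : ℕ∞) : WithTop ℚ := WithTop.map (fun m : ℕ => (m : ℚ)) n

@[simp] theorem toRat_natCast (n : ℕ) : toRat n = ((n : ℚ) : WithTop ℚ) := rfl

@[simp] theorem toRat_top : toRat ⊤ = ⊤ := rfl

/-- The order of a Puiseux series in terms of the order of the power series in `t`. -/
def ratOrder (e : ℕ) (n : ℕ∞) : WithTop ℚ := WithTop.map (fun m : ℕ => (m : ℚ) * (e : ℚ)⁻¹) n

theorem ratOrder_mono {e : ℕ} (he : 0 < e) : Monotone (ratOrder e) := by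
  apply Monotone.withTop_map
  intro a b h
  have : (0 : ℚ) < (e : ℚ)⁻¹ := inv_pos.mpr (Nat.cast_pos.mpr he)
  exact (mul_le_mul_iff_left₀ this).mpr (Nat.cast_le.mpr h)

theorem sum_ratOrder {e : ℕ} (he : 0 < e) (n : ℕ∞) :
    ∑ _i : Fin e, ratOrder e n = toRat n := by
  have he' : (e : ℚ) ≠ 0 := Nat.cast_ne_zero.mpr he.ne'
  induction n using ENat.recTopCoe with
  | top =>
    obtain ⟨e, rfl⟩ := Nat.exists_eq_succ_of_ne_zero he.ne'
    rw [Fin.sum_univ_succ]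
    exact WithTop.top_add _
  | coe n =>
    have : ratOrder e n = (((n : ℚ) * (e : ℚ)⁻¹ : ℚ) : WithTop ℚ) := rfl
    rw [this, ← WithTop.coe_sum]
    simp only [Finset.sum_const, Finset.card_univ, Fintype.card_fin, nsmul_eq_mul, toRat_natCast]
    congr 1
    field_simp

theorem orderTop_puiseux (e : ℕ) (he : 0 < e) (f : PowerSeries ℂ) :
    (puiseux e he f).orderTop = ratOrder e f.order := by
  by_cases hf : f = 0
  · subst hf
    rw [map_zero, HahnSeries.orderTop_zero, order_zero]
    rfl
  obtain ⟨n, hn⟩ := ENat.ne_top_iff_exists.mp (mt order_eq_top.mp hf)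
  rw [← hn]
  have hn' := order_eq_nat.mp hn.symm
  apply le_antisymm
  · apply HahnSeries.orderTop_le_of_coeff_ne_zero
    rw [puiseux_coeff]
    exact hn'.1
  · apply HahnSeries.le_orderTop_iff_forall.mpr
    intro q hq
    apply puiseux_coeff_eq_zero
    rintro m hm rfl
    have h2 : (m : ℚ) * (e : ℚ)⁻¹ < n * (e : ℚ)⁻¹ := WithTop.coe_lt_coe.mp hq
    have : (0 : ℚ) < (e : ℚ)⁻¹ := inv_pos.mpr (Nat.cast_pos.mpr he)
    have h3 := lt_of_mul_lt_mul_right h2 this.le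
    exact hm (hn'.2 m (by exact_mod_cast h3))

/-- The derivative with respect to `x = t ^ e` of a series in `t` of order at least `e`. -/
def slope (e : ℕ) (f : PowerSeries ℂ) : PowerSeries ℂ :=
  PowerSeries.mk fun m => ((m + e : ℂ) / e) * coeff (m + e) f

/-- Termwise, `d/dx` sends `t^n` to `(n/e) t^(n-e)`; the vanishing of the low coefficients keeps the
result free of negative powers of `t`. -/
theorem dx_puiseux (e : ℕ) (he : 0 < e) (f : PowerSeries ℂ) (hf : ∀ n < e, coeff n f = 0) :
    dx (puiseux e he f) = puiseux e he (slope e f) := by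
  have he' : (e : ℚ) ≠ 0 := Nat.cast_ne_zero.mpr he.ne'
  have he2 : (e : ℂ) ≠ 0 := Nat.cast_ne_zero.mpr he.ne'
  ext q
  change ((q + 1 : ℚ) : ℂ) * (puiseux e he f).coeff (q + 1) = _
  by_cases hq : ∃ m : ℕ, q = m * (e : ℚ)⁻¹
  · obtain ⟨m, rfl⟩ := hq
    have : (m : ℚ) * (e : ℚ)⁻¹ + 1 = ((m + e : ℕ) : ℚ) * (e : ℚ)⁻¹ := by
      push_cast
      field_simp
    rw [this, puiseux_coeff, puiseux_coeff, slope, coeff_mk]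
    push_cast
    rfl
  · rw [puiseux_coeff_eq_zero e he f, puiseux_coeff_eq_zero e he, mul_zero]
    · intro n _ h
      exact hq ⟨n, h⟩
    · intro n hn h
      have hen : e ≤ n := by
        by_contra hlt
        exact hn (hf n (by omega))
      refine hq ⟨n - e, ?_⟩
      rw [Nat.cast_sub hen, sub_mul, mul_inv_cancel₀ he', ← h]
      ring

theorem rescale_C (a c : ℂ) : rescale a (C c) = C c := by
  ext n
  rw [coeff_rescale, coeff_C]
  split_ifs with h <;> simp [h]

theorem slope_rescale (e : ℕ) (f : PowerSeries ℂ) {c : ℂ} (hc : c ^ e = 1) :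
    slope e (rescale c f) = rescale c (slope e f) := by
  ext m
  simp only [slope, coeff_mk, coeff_rescale, pow_add, hc]
  ring

/-! ### Pro-branches as images of the parametrization -/

theorem aeval_applyFrame_map {A A' : Type} [CommRing A] [Algebra ℂ A] [CommRing A']
    [Algebra ℂ A'] (θ : A →ₐ[ℂ] A') (M : GL (Fin 3) ℂ) (v : Fin 3 → A)
    (G : MvPolynomial (Fin 3) ℂ) :
    MvPolynomial.aeval (applyFrame M fun k => θ (v k)) G =
      θ (MvPolynomial.aeval (applyFrame M v) G) := by
  rw [← AlgHom.comp_apply, MvPolynomial.comp_aeval]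
  congr 2
  ext k
  simp [applyFrame]

namespace Branch

variable {F : MvPolynomial (Fin 3) ℂ} {M : GL (Fin 3) ℂ} (B : Branch F M)

/-- The root of unity that defines the `i`-th pro-branch. -/
def root (i : Fin B.e) : ℂ := Complex.exp (2 * Real.pi * Complex.I / B.e) ^ (i : ℕ)

theorem root_pow (i : Fin B.e) : B.root i ^ B.e = 1 := by
  rw [root, ← pow_mul, mul_comm (i : ℕ), pow_mul,
    (Complex.isPrimitiveRoot_exp B.e B.e_pos.ne').pow_eq_one, one_pow]

/-- The substitution `t ↦ ζ ^ i x ^ (1 / e)`. -/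
def proMap (i : Fin B.e) : PowerSeries ℂ →ₐ[ℂ] HahnSeries ℚ ℂ :=
  { (puiseux B.e B.e_pos).comp (rescale (B.root i)) with
    commutes' := fun c => by
      have h : algebraMap ℂ (PowerSeries ℂ) c = C c := rfl
      change puiseux B.e B.e_pos (rescale (B.root i) (algebraMap ℂ (PowerSeries ℂ) c)) = _
      rw [h, rescale_C, puiseux_C, HahnSeries.algebraMap_apply', h,
        HahnSeries.ofPowerSeries_C] }

theorem proMap_apply (i : Fin B.e) (f : PowerSeries ℂ) :
    B.proMap i f = puiseux B.e B.e_pos (rescale (B.root i) f) := rfl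

@[simp] theorem proMap_C (i : Fin B.e) (c : ℂ) : B.proMap i (C c) = HahnSeries.C c := by
  rw [proMap_apply, rescale_C, puiseux_C]

@[simp] theorem proMap_h (i : Fin B.e) : B.proMap i B.h = B.g i := rfl

@[simp] theorem proMap_X_pow (i : Fin B.e) : B.proMap i (X ^ B.e) = seriesX := by
  rw [proMap_apply, map_pow, rescale_X, mul_pow, ← map_pow, root_pow, map_one, one_mul,
    puiseux_X_pow]

@[simp] theorem proMap_slope (i : Fin B.e) : B.proMap i (slope B.e B.h) = dx (B.g i) := by
  rw [← proMap_h, proMap_apply, proMap_apply, dx_puiseux, slope_rescale _ _ (B.root_pow i)]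
  intro n hn
  rw [coeff_rescale, B.coeff_eq_zero n hn, mul_zero]

theorem order_rescale {c : ℂ} (hc : c ≠ 0) (f : PowerSeries ℂ) :
    (rescale c f).order = f.order := by
  rw [order_eq]
  constructor
  · intro i hi
    rw [coeff_rescale]
    have := (order_eq.mp (rfl : f.order = f.order)).1 i hi
    exact mul_ne_zero (pow_ne_zero _ hc) this
  · intro i hi
    rw [coeff_rescale, coeff_of_lt_order i hi, mul_zero]

theorem orderTop_proMap (i : Fin B.e) (f : PowerSeries ℂ) :
    (B.proMap i f).orderTop = ratOrder B.e f.order := by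
  have hc : B.root i ≠ 0 := fun h => by
    have := B.root_pow i
    rw [h, zero_pow B.e_pos.ne'] at this
    exact zero_ne_one this
  rw [proMap_apply, orderTop_puiseux, order_rescale hc]

/-- The parametrization `(t ^ e, h, 1)`. -/
def param : Fin 3 → PowerSeries ℂ := ![X ^ B.e, B.h, 1]

/-- The pro-branches are conjugate, so all `e` summands are the same order divided by `e`. -/
theorem inter_eq (G : MvPolynomial (Fin 3) ℂ) :
    B.inter G = toRat (MvPolynomial.aeval (applyFrame M B.param) G).order := by
  rw [← sum_ratOrder B.e_pos, inter]
  refine Finset.sum_congr rfl fun i _ => ?_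
  rw [← B.orderTop_proMap i, ← aeval_applyFrame_map]
  congr 4
  ext k : 1
  fin_cases k <;> simp [param]

/-- The series `W_P` in the parameter `t`. -/
def wSer (P : Fin 3 → ℂ) : PowerSeries ℂ :=
  C (P 1) - slope B.e B.h * C (P 0) + C (P 2) * (X ^ B.e * slope B.e B.h - B.h)

/-- The vector whose wedge with the parametrization is the series `R` in the parameter `t`. -/
def qSer (s : Fin 3 → ℂ) (k : Fin 3) : PowerSeries ℂ :=
  B.wSer (pullVec M vecI) * B.wSer (pullVec M vecJ) * C (pullVec M s k)
      - B.wSer (pullVec M s) * B.wSer (pullVec M vecI) * C (pullVec M vecJ k)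
      - B.wSer (pullVec M s) * B.wSer (pullVec M vecJ) * C (pullVec M vecI k)

theorem proMap_wSer (P : Fin 3 → ℂ) (i : Fin B.e) : B.proMap i (B.wSer P) = B.W P i := by
  simp only [wSer, W, map_add, map_sub, map_mul, proMap_C, proMap_h, proMap_X_pow, proMap_slope]

theorem proMap_qSer (s : Fin 3 → ℂ) (i : Fin B.e) (j : Fin 3) :
    B.Rhat s i j = B.proMap i (crossProduct B.param (B.qSer s) j) := by
  fin_cases j <;>
  simp [Rhat, qSer, param, cross_apply, proMap_wSer]

theorem contribution_eq (s : Fin 3 → ℂ) :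
    B.contribution s =
      toRat (Finset.univ.inf fun j => (crossProduct B.param (B.qSer s) j).order) := by
  rw [← sum_ratOrder B.e_pos, contribution]
  refine Finset.sum_congr rfl fun i _ => ?_
  rw [proContribution, Finset.apply_inf_eq_inf_comp_of_linearOrder _ (ratOrder_mono B.e_pos) rfl]
  congr 1
  ext j : 1
  rw [proMap_qSer, orderTop_proMap]
  rfl

end Branch

/-! ### Orders of power series -/

theorem le_order_iff_X_pow_dvd (f : PowerSeries ℂ) (n : ℕ) : (n : ℕ∞) ≤ f.order ↔ X ^ n ∣ f := by
  rw [X_pow_dvd_iff]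
  exact ⟨fun h m hm => coeff_of_lt_order m (lt_of_lt_of_le (by exact_mod_cast hm) h),
    fun h => nat_le_order f n h⟩

/-- The tool for every case: extract a common power of `t` and check that one of the cofactors is a
unit. -/
theorem min_order_eq {f g a b : PowerSeries ℂ} {N : ℕ} (hf : f = X ^ N * a) (hg : g = X ^ N * b)
    (h : constantCoeff a ≠ 0 ∨ constantCoeff b ≠ 0) : min f.order g.order = (N : ℕ∞) := by
  have key : ∀ c : PowerSeries ℂ, constantCoeff c ≠ 0 → (X ^ N * c).order = (N : ℕ∞) := by
    intro c hc
    rw [order_mul, order_X_pow, (order_eq_nat (n := 0)).mpr ⟨by simpa using hc, by simp⟩]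
    simp
  have key2 : ∀ c : PowerSeries ℂ, (N : ℕ∞) ≤ (X ^ N * c).order := fun c =>
    (le_order_iff_X_pow_dvd _ _).mpr (Dvd.intro _ rfl)
  subst hf hg
  rcases h with h | h
  · rw [key a h, min_eq_left (key2 b)]
  · rw [key b h, min_eq_right (key2 a)]

/-- The wedge is orthogonal to `(t^e, h, 1)`, so its last component is a combination of the first
two. Modulo the second component, the first one is `P`, by `hP`. Hence the same powers of `t` divide
both families. -/
theorem inf_order_cross (e : ℕ) (h D P : PowerSeries ℂ) (a : ℂ) (q : Fin 3 → PowerSeries ℂ)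
    (hP : q 1 - C a * q 0 - (h - C a * X ^ e) * q 2 = D * (q 0 - X ^ e * q 2) - P) :
    (Finset.univ.inf fun j => (crossProduct ![X ^ e, h, 1] q j).order) =
      min (q 0 - X ^ e * q 2).order P.order := by
  have hinf : ∀ f : Fin 3 → ℕ∞, Finset.univ.inf f = min (f 0) (min (f 1) (f 2)) := by
    intro f
    apply le_antisymm
    · exact le_min (Finset.inf_le (Finset.mem_univ _)) (le_min (Finset.inf_le (Finset.mem_univ _))
        (Finset.inf_le (Finset.mem_univ _)))
    · refine Finset.le_inf fun j _ => ?_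
      fin_cases j <;> simp
  rw [hinf]
  apply le_antisymm
  all_goals
    refine ENat.forall_natCast_le_iff_le.mp fun n => ?_
    simp only [le_min_iff, le_order_iff_X_pow_dvd, cross_apply, Matrix.cons_val_zero,
      Matrix.cons_val_one, Matrix.cons_val]
  · rintro ⟨h0, h1, -⟩
    rw [one_mul] at h1 h0
    refine ⟨h1, ?_⟩
    have : P = (D + C a) * (q 0 - X ^ e * q 2) + (h * q 2 - q 1) := by
      linear_combination hP
    rw [this]
    exact dvd_add (h1.mul_left _) h0
  · rintro ⟨h1, hp⟩
    have h0 : X ^ n ∣ h * q 2 - 1 * q 1 := by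
      have : h * q 2 - 1 * q 1 = P - (D + C a) * (q 0 - X ^ e * q 2) := by
        linear_combination -hP
      rw [this]
      exact dvd_sub hp (h1.mul_left _)
    refine ⟨h0, by rwa [one_mul], ?_⟩
    have : X ^ e * q 1 - h * q 0 = -X ^ e * (h * q 2 - 1 * q 1) - h * (q 0 - X ^ e * q 2) := by
      ring
    rw [this]
    exact dvd_sub (h0.mul_left _) (h1.mul_left _)

/-! ### Orders of the reduced series

In sheared coordinates the tangent line is `y = 0` and the branch is `x = t ^ e`,
`y = t ^ (k + e) * η`, with slope `t ^ k * δ`. -/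

/-- The series `W_P` in sheared coordinates. -/
def wRed (e k : ℕ) (δ η : PowerSeries ℂ) (P : Fin 3 → ℂ) : PowerSeries ℂ :=
  C (P 1) - X ^ k * δ * C (P 0) + X ^ (k + e) * (δ - η) * C (P 2)

/-- The abscissa of `P` relative to the branch. -/
def xRed (e : ℕ) (P : Fin 3 → ℂ) : PowerSeries ℂ := C (P 0) - X ^ e * C (P 2)

/-- The first coordinate of the reflected vector relative to the branch. -/
def rRed (e k : ℕ) (δ η : PowerSeries ℂ) (A B S : Fin 3 → ℂ) : PowerSeries ℂ :=
  wRed e k δ η A * wRed e k δ η B * xRed e S - wRed e k δ η S * wRed e k δ η A * xRed e B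
    - wRed e k δ η S * wRed e k δ η B * xRed e A

/-- The local order of the reduced vector. -/
def redOrder (e k : ℕ) (δ η : PowerSeries ℂ) (A B S : Fin 3 → ℂ) : ℕ∞ :=
  min (rRed e k δ η A B S).order (wRed e k δ η A * wRed e k δ η B * wRed e k δ η S).order

section

variable {e k : ℕ} {δ η : PowerSeries ℂ} {A B S P Q : Fin 3 → ℂ}

/-- This symmetry between the cyclic points lets each configuration be treated for one of them only.
-/
theorem redOrder_comm : redOrder e k δ η A B S = redOrder e k δ η B A S := by
  unfold redOrder rRed
  congr 2 <;> ring

theorem constantCoeff_wRed (hk : k ≠ 0) :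
    constantCoeff (wRed e k δ η P) = P 1 := by
  simp [wRed, hk]

theorem constantCoeff_xRed (he : e ≠ 0) :
    constantCoeff (xRed e P) = P 0 := by
  simp [xRed, he]

/-- The quotient by `t ^ k` of the series `W_P` of a point of the tangent line. -/
def wRedDiv (e : ℕ) (δ η : PowerSeries ℂ) (P : Fin 3 → ℂ) : PowerSeries ℂ :=
  X ^ e * (δ - η) * C (P 2) - δ * C (P 0)

theorem constantCoeff_wRedDiv (he : e ≠ 0) :
    constantCoeff (wRedDiv e δ η P) = -(constantCoeff δ * P 0) := by
  simp [wRedDiv, he]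

theorem wRed_of_mem (h : P 1 = 0) : wRed e k δ η P = X ^ k * wRedDiv e δ η P := by
  rw [wRed, wRedDiv, h, map_zero]
  ring

theorem wRed_of_center (h : P 1 = 0) (h0 : P 0 = 0) :
    wRed e k δ η P = X ^ (k + e) * ((δ - η) * C (P 2)) := by
  rw [wRed, h, h0, map_zero]
  ring

theorem xRed_of_center (h0 : P 0 = 0) : xRed e P = X ^ e * (-C (P 2)) := by
  rw [xRed, h0, map_zero]
  ring

/-- The terms in `t^k δ` cancel by antisymmetry, which gains a factor `t^e`. What remains carries a
determinant, nonzero when the two points of the tangent are distinct. -/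
theorem wRed_mul_xRed_sub (hP : P 1 = 0) (hQ : Q 1 = 0) :
    wRed e k δ η P * xRed e Q - wRed e k δ η Q * xRed e P =
      X ^ (k + e) * η * C (P 0 * Q 2 - P 2 * Q 0) := by
  rw [wRed, wRed, xRed, xRed, hP, hQ, map_zero, map_sub, map_mul, map_mul]
  ring

theorem wRed_mul_xRed_add (hP : P 1 = 0) (hQ : Q 1 = 0) :
    wRed e k δ η P * xRed e Q + wRed e k δ η Q * xRed e P =
      -(X ^ (k + e) * η * (C (P 2) * xRed e Q + C (Q 2) * xRed e P)) -
        2 * X ^ k * δ * xRed e P * xRed e Q := by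
  rw [wRed, wRed, xRed, xRed, hP, hQ, map_zero]
  ring

theorem redOrder_of_generic (hk : k ≠ 0) (hA : A 1 ≠ 0) (hB : B 1 ≠ 0)
    (hS : S 1 ≠ 0) : redOrder e k δ η A B S = 0 := by
  refine min_order_eq (N := 0) (by rw [pow_zero, one_mul]) (by rw [pow_zero, one_mul]) (Or.inr ?_)
  simp [constantCoeff_wRed hk, hA, hB, hS]

theorem redOrder_of_only_left (he : e ≠ 0) (hk : k ≠ 0) (hA : A 1 = 0) (hA0 : A 0 ≠ 0)
    (hB : B 1 ≠ 0) (hS : S 1 ≠ 0) : redOrder e k δ η A B S = 0 := by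
  refine min_order_eq (N := 0) (by rw [pow_zero, one_mul]) (by rw [pow_zero, one_mul]) (Or.inl ?_)
  simp [rRed, constantCoeff_wRed hk, constantCoeff_xRed he, hA, hA0, hB, hS]

theorem redOrder_of_only_source (he : e ≠ 0) (hk : k ≠ 0) (hA : A 1 ≠ 0) (hB : B 1 ≠ 0)
    (hS : S 1 = 0) (hS0 : S 0 ≠ 0) : redOrder e k δ η A B S = 0 := by
  refine min_order_eq (N := 0) (by rw [pow_zero, one_mul]) (by rw [pow_zero, one_mul]) (Or.inl ?_)
  simp [rRed, constantCoeff_wRed hk, constantCoeff_xRed he, hA, hB, hS, hS0]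

theorem redOrder_of_only_left_center (hk : k ≠ 0) (hA : A 1 = 0) (hA0 : A 0 = 0)
    (hA2 : A 2 ≠ 0) (hB : B 1 ≠ 0) (hS : S 1 ≠ 0) : redOrder e k δ η A B S = e := by
  refine min_order_eq
    (a := X ^ k * ((δ - η) * C (A 2)) * (wRed e k δ η B * xRed e S - wRed e k δ η S * xRed e B) +
      wRed e k δ η S * wRed e k δ η B * C (A 2))
    (b := X ^ k * ((δ - η) * C (A 2)) * wRed e k δ η B * wRed e k δ η S) ?_ ?_ (Or.inl ?_)
  · rw [rRed, wRed_of_center hA hA0, xRed_of_center hA0]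
    ring
  · rw [wRed_of_center hA hA0]
    ring
  · simp [constantCoeff_wRed hk, hA2, hB, hS, hk]

theorem redOrder_of_only_source_center (hk : k ≠ 0) (hA : A 1 ≠ 0) (hB : B 1 ≠ 0)
    (hS : S 1 = 0) (hS0 : S 0 = 0) (hS2 : S 2 ≠ 0) : redOrder e k δ η A B S = e := by
  refine min_order_eq
    (a := -(X ^ k * ((δ - η) * C (S 2)) * (wRed e k δ η A * xRed e B + wRed e k δ η B * xRed e A)) -
      wRed e k δ η A * wRed e k δ η B * C (S 2))
    (b := X ^ k * ((δ - η) * C (S 2)) * wRed e k δ η A * wRed e k δ η B) ?_ ?_ (Or.inl ?_)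
  · rw [rRed, wRed_of_center hS hS0, xRed_of_center hS0]
    ring
  · rw [wRed_of_center hS hS0]
    ring
  · simp [constantCoeff_wRed hk, hS2, hA, hB, hk]

theorem rRed_of_left_source (hA : A 1 = 0) (hS : S 1 = 0) :
    rRed e k δ η A B S = wRed e k δ η B * (X ^ (k + e) * η * C (A 0 * S 2 - A 2 * S 0)) -
      wRed e k δ η A * wRed e k δ η S * xRed e B := by
  rw [← wRed_mul_xRed_sub hA hS, rRed]
  ring

/-- Two terms of `rRed` compete, of orders `k + e` (the determinant term) and `2k` (from `W_A W_S`).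
-/
theorem redOrder_of_left_source (he : e ≠ 0) (hk : k ≠ 0) (hη : constantCoeff η ≠ 0)
    (hδ : constantCoeff δ ≠ 0) (hA : A 1 = 0) (hS : S 1 = 0) (hB : B 1 ≠ 0)
    (hAS : A 0 * S 2 - A 2 * S 0 ≠ 0) (hA0 : A 0 ≠ 0) (hS0 : S 0 ≠ 0) :
    redOrder e k δ η A B S = min (k + e : ℕ) (2 * k : ℕ) := by
  -- For `k = e` the leading terms of `rRed` might cancel. The triple product has order exactly
  -- `2k`, so it settles the tie together with `k < e`.
  rcases le_or_gt k e with h | h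
  · obtain ⟨m, rfl⟩ := Nat.exists_eq_add_of_le h
    rw [min_eq_right (by omega)]
    refine min_order_eq
      (a := X ^ m * wRed (k + m) k δ η B * η * C (A 0 * S 2 - A 2 * S 0) -
        wRedDiv (k + m) δ η A * wRedDiv (k + m) δ η S * xRed (k + m) B)
      (b := wRed (k + m) k δ η B * wRedDiv (k + m) δ η A * wRedDiv (k + m) δ η S)
      ?_ ?_ (Or.inr ?_)
    · rw [rRed_of_left_source hA hS, wRed_of_mem hA, wRed_of_mem hS]
      ring
    · rw [wRed_of_mem hA, wRed_of_mem hS]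
      ring
    · simp [constantCoeff_wRed hk, constantCoeff_wRedDiv he, hB, hδ, hA0, hS0]
  · obtain ⟨m, rfl⟩ := Nat.exists_eq_add_of_lt h
    rw [min_eq_left (by omega)]
    refine min_order_eq
      (a := wRed e (e + m + 1) δ η B * η * C (A 0 * S 2 - A 2 * S 0) -
        X ^ (m + 1) * wRedDiv e δ η A * wRedDiv e δ η S * xRed e B)
      (b := X ^ (m + 1) * wRed e (e + m + 1) δ η B * wRedDiv e δ η A * wRedDiv e δ η S)
      ?_ ?_ (Or.inl ?_)
    · rw [rRed_of_left_source hA hS, wRed_of_mem hA, wRed_of_mem hS]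
      ring
    · rw [wRed_of_mem hA, wRed_of_mem hS]
      ring
    · simp only [map_sub, map_mul, constantCoeff_wRed hk, constantCoeff_C, map_pow,
        constantCoeff_X, zero_pow (Nat.succ_ne_zero m), zero_mul, sub_zero] at hAS ⊢
      exact mul_ne_zero (mul_ne_zero hB hη) hAS

/-- With one of the two points at the center, `W_A W_S` is divisible by `t^(2k+e)`, so the
determinant term of order `k + e` wins. -/
theorem redOrder_of_left_source_center (hk : k ≠ 0) (hη : constantCoeff η ≠ 0)
    (hA : A 1 = 0) (hS : S 1 = 0) (hB : B 1 ≠ 0)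
    (hAS : A 0 * S 2 - A 2 * S 0 ≠ 0) (h0 : A 0 = 0 ∨ S 0 = 0) :
    redOrder e k δ η A B S = (k + e : ℕ) := by
  obtain ⟨r, hr⟩ : ∃ r, wRed e k δ η A * wRed e k δ η S = X ^ (k + e) * (X ^ k * r) := by
    rcases h0 with h0 | h0
    · exact ⟨(δ - η) * C (A 2) * wRedDiv e δ η S, by
        rw [wRed_of_center hA h0, wRed_of_mem hS]; ring⟩
    · exact ⟨(δ - η) * C (S 2) * wRedDiv e δ η A, by
        rw [wRed_of_center hS h0, wRed_of_mem hA]; ring⟩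
  refine min_order_eq
    (a := wRed e k δ η B * η * C (A 0 * S 2 - A 2 * S 0) - X ^ k * r * xRed e B)
    (b := X ^ k * r * wRed e k δ η B) ?_ ?_ (Or.inl ?_)
  · rw [rRed_of_left_source hA hS, hr]
    ring
  · linear_combination wRed e k δ η B * hr
  · simp only [map_sub, map_mul, constantCoeff_wRed hk, constantCoeff_C, map_pow,
        constantCoeff_X, zero_pow hk, zero_mul, sub_zero] at hAS ⊢
    exact mul_ne_zero (mul_ne_zero hB hη) hAS

theorem rRed_of_left_right (hA : A 1 = 0) (hB : B 1 = 0) :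
    rRed e k δ η A B S = wRed e k δ η A * wRed e k δ η B * xRed e S +
      wRed e k δ η S * (X ^ (k + e) * η * (C (A 2) * xRed e B + C (B 2) * xRed e A) +
        2 * X ^ k * δ * xRed e A * xRed e B) := by
  rw [rRed]
  linear_combination -wRed e k δ η S * wRed_mul_xRed_add (δ := δ) (η := η) (e := e) (k := k) hA hB

theorem redOrder_of_left_right (he : e ≠ 0) (hk : k ≠ 0)
    (hδ : constantCoeff δ ≠ 0) (hA : A 1 = 0) (hB : B 1 = 0) (hS : S 1 ≠ 0)
    (hA0 : A 0 ≠ 0) (hB0 : B 0 ≠ 0) : redOrder e k δ η A B S = k := by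
  refine min_order_eq
    (a := X ^ k * wRedDiv e δ η A * wRedDiv e δ η B * xRed e S +
      wRed e k δ η S * (X ^ e * η * (C (A 2) * xRed e B + C (B 2) * xRed e A) +
        2 * δ * xRed e A * xRed e B))
    (b := X ^ k * wRedDiv e δ η A * wRedDiv e δ η B * wRed e k δ η S) ?_ ?_ (Or.inl ?_)
  · rw [rRed_of_left_right hA hB, wRed_of_mem hA, wRed_of_mem hB]
    ring
  · rw [wRed_of_mem hA, wRed_of_mem hB]
    ring
  · have h2 : constantCoeff (2 : PowerSeries ℂ) = 2 := map_ofNat _ 2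
    simp [h2, constantCoeff_wRed hk, constantCoeff_xRed he, hk, he, hS, hδ, hA0, hB0]

/-- At order `k + e` the contributions of `η` and `2δ` merge into the coefficient `-(2δ(0) - η(0))`,
up to nonzero coordinates. -/
theorem redOrder_of_left_center_right (he : e ≠ 0) (hk : k ≠ 0)
    (hδ : 2 * constantCoeff δ - constantCoeff η ≠ 0) (hA : A 1 = 0) (hB : B 1 = 0) (hS : S 1 ≠ 0)
    (hA0 : A 0 = 0) (hA2 : A 2 ≠ 0) (hB0 : B 0 ≠ 0) :
    redOrder e k δ η A B S = (k + e : ℕ) := by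
  refine min_order_eq
    (a := X ^ k * (δ - η) * C (A 2) * wRedDiv e δ η B * xRed e S +
      wRed e k δ η S * (η * (C (A 2) * xRed e B - X ^ e * C (B 2) * C (A 2)) -
        2 * δ * C (A 2) * xRed e B))
    (b := X ^ k * (δ - η) * C (A 2) * wRedDiv e δ η B * wRed e k δ η S) ?_ ?_ (Or.inl ?_)
  · rw [rRed_of_left_right hA hB, wRed_of_center hA hA0, wRed_of_mem hB, xRed_of_center hA0]
    ring
  · rw [wRed_of_center hA hA0, wRed_of_mem hB]
    ring
  · have h2 : constantCoeff (2 : PowerSeries ℂ) = 2 := map_ofNat _ 2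
    simp only [map_add, map_sub, map_mul, constantCoeff_wRed hk, constantCoeff_xRed he,
      constantCoeff_C, map_pow, constantCoeff_X, zero_pow hk, zero_pow he, zero_mul, sub_zero,
      zero_add, h2]
    have := mul_ne_zero (mul_ne_zero hS hδ) (mul_ne_zero hA2 hB0)
    contrapose! this
    linear_combination -this

/-- The three terms of `rRed` share the leading term `δ(0)² A₀ B₀ S₀ t^(2k)`, with signs `+, -, -`,
so they do not cancel. -/
theorem redOrder_of_all (he : e ≠ 0)
    (hδ : constantCoeff δ ≠ 0) (hA : A 1 = 0) (hB : B 1 = 0) (hS : S 1 = 0)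
    (hA0 : A 0 ≠ 0) (hB0 : B 0 ≠ 0) (hS0 : S 0 ≠ 0) :
    redOrder e k δ η A B S = (2 * k : ℕ) := by
  refine min_order_eq
    (a := wRedDiv e δ η A * wRedDiv e δ η B * xRed e S
      - wRedDiv e δ η S * wRedDiv e δ η A * xRed e B
      - wRedDiv e δ η S * wRedDiv e δ η B * xRed e A)
    (b := X ^ k * wRedDiv e δ η A * wRedDiv e δ η B * wRedDiv e δ η S) ?_ ?_ (Or.inl ?_)
  · rw [rRed, wRed_of_mem hA, wRed_of_mem hB, wRed_of_mem hS]
    ring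
  · rw [wRed_of_mem hA, wRed_of_mem hB, wRed_of_mem hS]
    ring
  · simp only [map_sub, map_mul, constantCoeff_wRedDiv he, constantCoeff_xRed he]
    have := mul_ne_zero (pow_ne_zero 2 hδ) (mul_ne_zero hA0 (mul_ne_zero hB0 hS0))
    contrapose! this
    linear_combination -this

/-- Grouping the two terms that contain `W_A` exhibits the antisymmetric difference for `B` and `S`,
which pushes them to order at least `2k + 2e`; the term `W_S W_B x_A` has order `2k + e`. -/
theorem redOrder_of_all_left_center (he : e ≠ 0)
    (hδ : constantCoeff δ ≠ 0) (hA : A 1 = 0) (hB : B 1 = 0) (hS : S 1 = 0)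
    (hA0 : A 0 = 0) (hA2 : A 2 ≠ 0) (hB0 : B 0 ≠ 0) (hS0 : S 0 ≠ 0) :
    redOrder e k δ η A B S = (2 * k + e : ℕ) := by
  refine min_order_eq
    (a := X ^ e * (δ - η) * C (A 2) * η * C (B 0 * S 2 - B 2 * S 0)
      + wRedDiv e δ η S * wRedDiv e δ η B * C (A 2))
    (b := X ^ k * (δ - η) * C (A 2) * wRedDiv e δ η B * wRedDiv e δ η S) ?_ ?_ (Or.inl ?_)
  · have h1 := wRed_mul_xRed_sub (δ := δ) (η := η) (e := e) (k := k) hB hS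
    have h2 : rRed e k δ η A B S = wRed e k δ η A *
        (wRed e k δ η B * xRed e S - wRed e k δ η S * xRed e B) -
        wRed e k δ η S * wRed e k δ η B * xRed e A := by
      rw [rRed]
      ring
    rw [h2, h1, wRed_of_center hA hA0, wRed_of_mem hB, wRed_of_mem hS, xRed_of_center hA0]
    ring
  · rw [wRed_of_center hA hA0, wRed_of_mem hB, wRed_of_mem hS]
    ring
  · simp [constantCoeff_wRedDiv he, he, hδ, hA2, hB0, hS0]

theorem rRed_of_all_source_center (hA : A 1 = 0) (hB : B 1 = 0) (hS : S 1 = 0) (hS0 : S 0 = 0) :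
    rRed e k δ η A B S = X ^ (2 * k + e) * C (S 2) * (C (A 0) * C (B 0) * δ * (δ - 2 * η) +
      X ^ e * (δ - η) ^ 2 * (X ^ e * C (A 2) * C (B 2) - (C (A 0) * C (B 2) + C (A 2) * C (B 0))))
      := by
  rw [rRed, wRed_of_mem hA, wRed_of_mem hB, wRed_of_center hS hS0, xRed_of_center hS0, xRed, xRed,
    wRedDiv, wRedDiv]
  ring

theorem redOrder_of_all_source_center (he : e ≠ 0)
    (hδ : constantCoeff δ ≠ 0) (hδη : constantCoeff δ - 2 * constantCoeff η ≠ 0)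
    (hA : A 1 = 0) (hB : B 1 = 0) (hS : S 1 = 0)
    (hA0 : A 0 ≠ 0) (hB0 : B 0 ≠ 0) (hS0 : S 0 = 0) (hS2 : S 2 ≠ 0) :
    redOrder e k δ η A B S = (2 * k + e : ℕ) := by
  refine min_order_eq
    (b := X ^ k * (δ - η) * C (S 2) * wRedDiv e δ η B * wRedDiv e δ η A)
    ((rRed_of_all_source_center hA hB hS hS0).trans (mul_assoc _ _ _)) ?_ (Or.inl ?_)
  · rw [wRed_of_center hS hS0, wRed_of_mem hB, wRed_of_mem hA]
    ring
  · have h2 : constantCoeff (2 : PowerSeries ℂ) = 2 := map_ofNat _ 2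
    simp [he, hδ, hA0, hB0, hS2, h2, hδη]

/-- For `k = e`, the factor `δ - 2η` in `rRed` competes with a correction of relative order at least
`e`. If its order is below `e` it decides; otherwise both series are divisible by `t^(4e)`, and the
triple product has exactly this order. -/
theorem redOrder_of_all_source_center_inflection (he : e ≠ 0)
    (hδ : constantCoeff δ ≠ 0) (hδη : constantCoeff δ - constantCoeff η ≠ 0)
    (hA : A 1 = 0) (hB : B 1 = 0) (hS : S 1 = 0)
    (hA0 : A 0 ≠ 0) (hB0 : B 0 ≠ 0) (hS0 : S 0 = 0) (hS2 : S 2 ≠ 0) :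
    redOrder e e δ η A B S = 3 * e + min (δ - 2 * η).order e := by
  have hp : wRed e e δ η A * wRed e e δ η B * wRed e e δ η S =
      X ^ (4 * e) * (wRedDiv e δ η A * wRedDiv e δ η B * (δ - η) * C (S 2)) := by
    rw [wRed_of_center hS hS0, wRed_of_mem hB, wRed_of_mem hA]
    ring
  have hr := rRed_of_all_source_center (e := e) (k := e) (δ := δ) (η := η) hA hB hS hS0
  rcases lt_or_ge (δ - 2 * η).order (e : ℕ∞) with h | h
  · obtain ⟨m, hm⟩ := ENat.ne_top_iff_exists.mp (ne_top_of_lt h)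
    rw [min_eq_left h.le, ← hm]
    rw [← hm] at h
    obtain ⟨τ, hτ⟩ := (le_order_iff_X_pow_dvd (δ - 2 * η) m).mp hm.le
    have hτ0 : constantCoeff τ ≠ 0 := by
      have := (order_eq_nat.mp hm.symm).1
      rwa [hτ, coeff_X_pow_mul', if_pos le_rfl, Nat.sub_self,
        coeff_zero_eq_constantCoeff_apply] at this
    obtain ⟨r, hr'⟩ := Nat.exists_eq_add_of_lt (show m < e by exact_mod_cast h)
    rw [hτ] at hr
    have hN : (3 * (e : ℕ∞) + (m : ℕ∞)) = ((3 * e + m : ℕ) : ℕ∞) := by push_cast; rfl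
    rw [hN]
    refine min_order_eq
      (a := C (S 2) * (C (A 0) * C (B 0) * δ * τ + X ^ (r + 1) * (δ - η) ^ 2 *
        (X ^ e * C (A 2) * C (B 2) - (C (A 0) * C (B 2) + C (A 2) * C (B 0)))))
      (b := X ^ (r + 1) * (wRedDiv e δ η A * wRedDiv e δ η B * (δ - η) * C (S 2))) ?_ ?_
      (Or.inl ?_)
    · rw [hr]
      have : (X : PowerSeries ℂ) ^ e = X ^ m * X ^ (r + 1) := by rw [← pow_add, hr', add_assoc]
      linear_combination X ^ (2 * e + e) * C (S 2) * (δ - η) ^ 2 *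
        (X ^ e * C (A 2) * C (B 2) - (C (A 0) * C (B 2) + C (A 2) * C (B 0))) * this
    · rw [hp, ← mul_assoc (X ^ (3 * e + m)), ← pow_add]
      congr 2
      omega
    · simp [hS2, hA0, hB0, hδ, hτ0]
  · rw [min_eq_right h]
    obtain ⟨τ, hτ⟩ := (le_order_iff_X_pow_dvd (δ - 2 * η) e).mp h
    rw [hτ] at hr
    have hN : (3 * (e : ℕ∞) + (e : ℕ∞)) = ((4 * e : ℕ) : ℕ∞) := by norm_cast; omega
    rw [hN]
    refine min_order_eq
      (a := C (S 2) * (C (A 0) * C (B 0) * δ * τ + (δ - η) ^ 2 *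
        (X ^ e * C (A 2) * C (B 2) - (C (A 0) * C (B 2) + C (A 2) * C (B 0)))))
      ?_ hp (Or.inr ?_)
    · rw [hr]
      ring
    · simp [constantCoeff_wRedDiv he, hS2, hA0, hB0, hδ, hδη]

end

/-! ### Frames and homogeneous forms -/

theorem pullVec_injective (M : GL (Fin 3) ℂ) : Function.Injective (pullVec M) :=
  Matrix.mulVec_injective_of_isUnit (Units.isUnit M⁻¹)

theorem pullVec_smul (M : GL (Fin 3) ℂ) (c : ℂ) (v : Fin 3 → ℂ) :
    pullVec M (c • v) = c • pullVec M v :=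
  Matrix.mulVec_smul _ _ _

theorem pullVec_mulVec (M : GL (Fin 3) ℂ) (v : Fin 3 → ℂ) :
    pullVec M ((M : Matrix (Fin 3) (Fin 3) ℂ).mulVec v) = v := by
  rw [pullVec, Matrix.mulVec_mulVec, ← Units.val_mul, inv_mul_cancel, Units.val_one,
    Matrix.one_mulVec]

theorem mulVec_pullVec (M : GL (Fin 3) ℂ) (v : Fin 3 → ℂ) :
    (M : Matrix (Fin 3) (Fin 3) ℂ).mulVec (pullVec M v) = v := by
  rw [pullVec, Matrix.mulVec_mulVec, ← Units.val_mul, mul_inv_cancel, Units.val_one,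
    Matrix.one_mulVec]

theorem sum_inv_smul_applyFrame {A : Type} [CommRing A] [Algebra ℂ A] (M : GL (Fin 3) ℂ)
    (v : Fin 3 → A) (i : Fin 3) :
    ∑ k, ((M⁻¹ : GL (Fin 3) ℂ) : Matrix (Fin 3) (Fin 3) ℂ) i k • applyFrame M v k = v i := by
  have h : (((M⁻¹ : GL (Fin 3) ℂ) : Matrix (Fin 3) (Fin 3) ℂ) *
      (M : Matrix (Fin 3) (Fin 3) ℂ)) = 1 := by
    rw [← Units.val_mul, inv_mul_cancel, Units.val_one]
  simp only [applyFrame, Finset.smul_sum, smul_smul]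
  rw [Finset.sum_comm]
  simp only [← Finset.sum_smul]
  have h2 : ∀ j, ∑ k, ((M⁻¹ : GL (Fin 3) ℂ) : Matrix (Fin 3) (Fin 3) ℂ) i k *
      (M : Matrix (Fin 3) (Fin 3) ℂ) k j = (1 : Matrix (Fin 3) (Fin 3) ℂ) i j := fun j => by
    rw [← h, Matrix.mul_apply]
  simp only [h2, Matrix.one_apply, ite_smul, one_smul, zero_smul, Finset.sum_ite_eq,
    Finset.mem_univ, if_true]

theorem eval_smul_of_isHomogeneous {G : MvPolynomial (Fin 3) ℂ} {n : ℕ} (hG : G.IsHomogeneous n)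
    (c : ℂ) (v : Fin 3 → ℂ) :
    MvPolynomial.eval (c • v) G = c ^ n * MvPolynomial.eval v G := by
  rw [MvPolynomial.eval_eq, MvPolynomial.eval_eq, Finset.mul_sum]
  refine Finset.sum_congr rfl fun m hm => ?_
  have hd := hG (MvPolynomial.mem_support_iff.mp hm)
  have h2 : ∏ i ∈ m.support, c ^ m i = c ^ n := by
    rw [Finset.prod_pow_eq_pow_sum, ← hd, Finsupp.weight_apply, Finsupp.sum]
    simp
  simp only [Pi.smul_apply, smul_eq_mul, mul_pow, Finset.prod_mul_distrib, h2]
  ring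

theorem mk_mem_zeroLocus {G : MvPolynomial (Fin 3) ℂ} {n : ℕ} (hG : G.IsHomogeneous n)
    (v : Fin 3 → ℂ) (hv : v ≠ 0) :
    (Projectivization.mk ℂ v hv : P2) ∈ zeroLocus G ↔ MvPolynomial.eval v G = 0 := by
  obtain ⟨c, hc⟩ := Projectivization.exists_smul_eq_mk_rep ℂ v hv
  rw [zeroLocus, Set.mem_ofPred_eq, ← hc, Units.smul_def, eval_smul_of_isHomogeneous hG,
    mul_eq_zero, or_iff_right (pow_ne_zero _ c.ne_zero)]

/-! ### Sheared coordinates, the tangent line and the normal form of a branch -/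

namespace Branch

variable {F : MvPolynomial (Fin 3) ℂ} {M : GL (Fin 3) ℂ} (B : Branch F M)

/-- The slope of the tangent line. -/
def tangentSlope : ℂ := coeff B.e B.h

/-- The coordinates of a vector in the frame `M`, sheared so that the tangent line is `y = 0`. -/
def coord (v : Fin 3 → ℂ) : Fin 3 → ℂ :=
  ![pullVec M v 0, pullVec M v 1 - B.tangentSlope * pullVec M v 0, pullVec M v 2]

theorem coord_injective : Function.Injective B.coord := by
  intro v w h
  apply pullVec_injective M
  have h0 := congrFun h 0
  have h1 := congrFun h 1
  have h2 := congrFun h 2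
  simp only [coord, Matrix.cons_val_zero, Matrix.cons_val_one, Matrix.cons_val] at h0 h1 h2
  ext i
  fin_cases i
  · exact h0
  · change pullVec M v 1 = pullVec M w 1
    linear_combination h1 + B.tangentSlope * h0
  · exact h2

theorem coord_smul (c : ℂ) (v : Fin 3 → ℂ) : B.coord (c • v) = c • B.coord v := by
  ext i
  fin_cases i <;> simp [coord, pullVec_smul]
  ring

theorem coord_zero : B.coord 0 = 0 := by
  simpa using B.coord_smul 0 0

theorem coord_center :
    B.coord ((M : Matrix (Fin 3) (Fin 3) ℂ).mulVec ![0, 0, 1]) = ![0, 0, 1] := by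
  simp [coord, pullVec_mulVec]

theorem isHomogeneous_tangentForm : B.tangentForm.IsHomogeneous 1 := by
  refine MvPolynomial.IsHomogeneous.sum _ _ _ fun k _ => ?_
  exact (MvPolynomial.isHomogeneous_C _ _).mul (MvPolynomial.isHomogeneous_X _ _)

theorem eval_tangentForm (v : Fin 3 → ℂ) : MvPolynomial.eval v B.tangentForm = B.coord v 1 := by
  simp [tangentForm, coord, tangentSlope, pullVec, Matrix.mulVec, dotProduct, Fin.sum_univ_three]
  ring

theorem mk_mem_tangentLine (v : Fin 3 → ℂ) (hv : v ≠ 0) :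
    Projectivization.mk ℂ v hv ∈ B.tangentLine ↔ B.coord v 1 = 0 := by
  rw [tangentLine, mk_mem_zeroLocus B.isHomogeneous_tangentForm, eval_tangentForm]

theorem mk_eq_mk_iff_coord (v w : Fin 3 → ℂ) (hv : v ≠ 0) (hw : w ≠ 0) :
    Projectivization.mk ℂ v hv = Projectivization.mk ℂ w hw ↔
      ∃ c : ℂ, c • B.coord w = B.coord v := by
  rw [Projectivization.mk_eq_mk_iff']
  constructor
  · rintro ⟨c, rfl⟩
    exact ⟨c, (B.coord_smul c w).symm⟩
  · rintro ⟨c, hc⟩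
    exact ⟨c, B.coord_injective ((B.coord_smul c w).trans hc)⟩

theorem mk_eq_frameCenter_iff (v : Fin 3 → ℂ) (hv : v ≠ 0) :
    Projectivization.mk ℂ v hv = frameCenter M ↔ B.coord v 1 = 0 ∧ B.coord v 0 = 0 := by
  rw [frameCenter, B.mk_eq_mk_iff_coord, coord_center]
  constructor
  · rintro ⟨c, hc⟩
    rw [← hc]
    simp
  · rintro ⟨h1, h0⟩
    refine ⟨B.coord v 2, ?_⟩
    ext i
    fin_cases i <;> simp [h0, h1]

theorem coord_two_ne_zero {v : Fin 3 → ℂ} (hv : v ≠ 0) (h1 : B.coord v 1 = 0)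
    (h0 : B.coord v 0 = 0) : B.coord v 2 ≠ 0 := by
  intro h2
  apply hv
  apply B.coord_injective
  rw [coord_zero]
  ext i
  fin_cases i
  exacts [h0, h1, h2]

theorem coord_det_ne_zero {v w : Fin 3 → ℂ} (hv : v ≠ 0) (hw : w ≠ 0)
    (hvw : Projectivization.mk ℂ v hv ≠ Projectivization.mk ℂ w hw)
    (hv1 : B.coord v 1 = 0) (hw1 : B.coord w 1 = 0) :
    B.coord v 0 * B.coord w 2 - B.coord v 2 * B.coord w 0 ≠ 0 := by
  intro hdet
  apply hvw
  rw [B.mk_eq_mk_iff_coord]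
  by_cases hw0 : B.coord w 0 = 0
  · have hw2 := B.coord_two_ne_zero hw hw1 hw0
    have hv0 : B.coord v 0 = 0 := by
      rw [hw0, mul_zero, sub_zero] at hdet
      exact (mul_eq_zero.mp hdet).resolve_right hw2
    refine ⟨B.coord v 2 / B.coord w 2, ?_⟩
    ext i
    fin_cases i
    · simp [hw0, hv0]
    · simp [hw1, hv1]
    · simp [hw2]
  · refine ⟨B.coord v 0 / B.coord w 0, ?_⟩
    ext i
    fin_cases i
    · simp [hw0]
    · simp [hw1, hv1]
    · simp only [Pi.smul_apply, smul_eq_mul, Fin.reduceFinMk]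
      field_simp
      linear_combination hdet

/-- The branch is not contained in its tangent line. -/
theorem h_ne_tangent {d : ℕ} (hd : 2 ≤ d) (hF : F.IsHomogeneous d) (hirr : Irreducible F) :
    B.h ≠ C B.tangentSlope * X ^ B.e := by
  intro hh
  have he : B.e = 1 := by
    refine B.primitive B.e dvd_rfl fun n hn => ?_
    rw [hh, coeff_C_mul, coeff_X_pow] at hn
    split_ifs at hn with h
    · rw [h]
    · simp at hn
  have hcurve := B.on_curve
  rw [hh, he, pow_one] at hcurve
  have hpt : ∀ t : ℂ, MvPolynomial.eval
      ((M : Matrix (Fin 3) (Fin 3) ℂ).mulVec ![t, B.tangentSlope * t, 1]) F = 0 := by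
    -- The identity between power series already holds between polynomials, where `t` can be
    -- specialized to complex numbers.
    have hpoly : MvPolynomial.aeval (applyFrame M
        ![(Polynomial.X : Polynomial ℂ), Polynomial.C B.tangentSlope * Polynomial.X, 1]) F = 0 := by
      apply Polynomial.coe_injective ℂ
      have h1 := aeval_applyFrame_map (Polynomial.coeToPowerSeries.algHom (R := ℂ) ℂ) M
        ![(Polynomial.X : Polynomial ℂ), Polynomial.C B.tangentSlope * Polynomial.X, 1] F
      have h2 : (fun k => Polynomial.coeToPowerSeries.algHom (R := ℂ) ℂ
          (![(Polynomial.X : Polynomial ℂ), Polynomial.C B.tangentSlope * Polynomial.X, 1] k)) =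
          ![(X : PowerSeries ℂ), C B.tangentSlope * X, 1] := by
        ext k : 1
        fin_cases k <;> simp [Polynomial.coeToPowerSeries.algHom_apply]
      rw [h2, hcurve, Polynomial.coeToPowerSeries.algHom_apply] at h1
      simpa using h1.symm
    intro t
    have h1 := aeval_applyFrame_map (Polynomial.aeval t) M
        ![(Polynomial.X : Polynomial ℂ), Polynomial.C B.tangentSlope * Polynomial.X, 1] F
    rw [hpoly, map_zero] at h1
    rw [← h1, MvPolynomial.aeval_eq_eval]
    congr 2
    ext k
    simp [applyFrame, Matrix.mulVec, dotProduct, Fin.sum_univ_three]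
  -- Homogeneity extends the vanishing from `z = 1` to `z ≠ 0`, and continuity to `z = 0`.
  have hpt2 : ∀ x z : ℂ, MvPolynomial.eval
      ((M : Matrix (Fin 3) (Fin 3) ℂ).mulVec ![x, B.tangentSlope * x, z]) F = 0 := by
    intro x
    have hc : Continuous fun z : ℂ => MvPolynomial.eval
      ((M : Matrix (Fin 3) (Fin 3) ℂ).mulVec ![x, B.tangentSlope * x, z]) F := by
      refine (MvPolynomial.continuous_eval F).comp ?_
      refine Continuous.matrix_mulVec continuous_const ?_
      refine continuous_pi fun i => ?_
      fin_cases i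
      · exact continuous_const
      · exact continuous_const
      · exact continuous_id
    have := hc.ext_on (dense_compl_singleton (0 : ℂ)) (continuous_const (y := (0 : ℂ))) ?_
    · exact fun z => congrFun this z
    · intro z hz
      have hz : z ≠ 0 := hz
      have hv : ![x, B.tangentSlope * x, z] = z • ![x / z, B.tangentSlope * (x / z), 1] := by
        ext i
        fin_cases i
        · simp
          field_simp
        · simp
          field_simp
        · simp
      change MvPolynomial.eval _ F = 0
      rw [hv, Matrix.mulVec_smul, eval_smul_of_isHomogeneous hF, hpt, mul_zero]
  -- `F` vanishes on the tangent line. By the Nullstellensatz the linear form divides a power of the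
  -- prime `F`, so it is associated to a power of `F`, which its degree forbids.
  have hvan : F ∈ MvPolynomial.vanishingIdeal ℂ
      (MvPolynomial.zeroLocus ℂ (Ideal.span {B.tangentForm})) := by
    intro v hv
    have h1 := hv B.tangentForm (Ideal.mem_span_singleton_self _)
    rw [MvPolynomial.aeval_eq_eval] at h1 ⊢
    have h1 : B.coord v 1 = 0 := by
      rw [← eval_tangentForm]
      exact h1
    have h2 := hpt2 (pullVec M v 0) (pullVec M v 2)
    have h3 : ![pullVec M v 0, B.tangentSlope * pullVec M v 0, pullVec M v 2] = pullVec M v := by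
      ext i
      fin_cases i
      · rfl
      · simp only [coord, Matrix.cons_val_one, Matrix.cons_val_zero] at h1
        exact (sub_eq_zero.mp h1).symm
      · rfl
    rw [h3, mulVec_pullVec] at h2
    exact h2
  rw [MvPolynomial.vanishingIdeal_zeroLocus_eq_radical] at hvan
  obtain ⟨n, hn⟩ := hvan
  rw [Ideal.mem_span_singleton, dvd_prime_pow hirr.prime] at hn
  obtain ⟨i, -, hi⟩ := hn
  have hL0 : B.tangentForm ≠ 0 := by
    intro h0
    have h1 := B.eval_tangentForm ((M : Matrix (Fin 3) (Fin 3) ℂ).mulVec ![0, 1, 0])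
    rw [h0] at h1
    simp [coord, pullVec_mulVec] at h1
  rcases Nat.eq_zero_or_pos i with rfl | hi0
  · rw [pow_zero, associated_one_iff_isUnit] at hi
    have h1 := hi.map (MvPolynomial.eval (0 : Fin 3 → ℂ))
    rw [eval_tangentForm, coord_zero] at h1
    simp at h1
  · have hdvd : F ∣ B.tangentForm := (dvd_pow_self F hi0.ne').trans hi.symm.dvd
    have h1 := MvPolynomial.totalDegree_le_of_dvd_of_isDomain hdvd hL0
    rw [hF.totalDegree hirr.ne_zero, B.isHomogeneous_tangentForm.totalDegree hL0] at h1
    omega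

/-- Removing the tangent term kills all exponents up to `e`, so the remainder has some order `k + e`
with `k > 0`; differentiating termwise gives `δ`. -/
theorem exists_normal_form (hu : B.h ≠ C B.tangentSlope * X ^ B.e) :
    ∃ (k : ℕ) (δ η : PowerSeries ℂ), k ≠ 0 ∧ constantCoeff η ≠ 0 ∧
      (∀ m, coeff m δ = ((m + k + B.e : ℂ) / B.e) * coeff m η) ∧
      B.h = C B.tangentSlope * X ^ B.e + X ^ (k + B.e) * η ∧
      slope B.e B.h = C B.tangentSlope + X ^ k * δ := by
  have he : (B.e : ℂ) ≠ 0 := Nat.cast_ne_zero.mpr B.e_pos.ne'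
  set u := B.h - C B.tangentSlope * X ^ B.e with hudef
  have hu0 : u ≠ 0 := sub_ne_zero.mpr hu
  obtain ⟨n, hn⟩ := ENat.ne_top_iff_exists.mp (mt order_eq_top.mp hu0)
  have hlow : ∀ m ≤ B.e, coeff m u = 0 := by
    intro m hm
    rw [hudef, map_sub, coeff_C_mul, coeff_X_pow]
    rcases hm.lt_or_eq with h | rfl
    · rw [B.coeff_eq_zero m h, if_neg h.ne]
      simp
    · simp [tangentSlope]
  have hn' := order_eq_nat.mp hn.symm
  obtain ⟨η, hη⟩ := (le_order_iff_X_pow_dvd u n).mp hn.le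
  have hen : B.e < n := by
    by_contra h
    exact hn'.1 (hlow n (by omega))
  obtain ⟨k, rfl⟩ : ∃ k, n = k + B.e := ⟨n - B.e, by omega⟩
  have hh : B.h = C B.tangentSlope * X ^ B.e + X ^ (k + B.e) * η := by
    rw [← hη, hudef]
    ring
  refine ⟨k, PowerSeries.mk fun m => ((m + k + B.e : ℂ) / B.e) * coeff m η, η, by omega, ?_,
    fun m => coeff_mk _ _, hh, ?_⟩
  · have := hn'.1
    rwa [hη, coeff_X_pow_mul', if_pos le_rfl, Nat.sub_self,
      coeff_zero_eq_constantCoeff_apply] at this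
  · ext m
    rw [slope, coeff_mk]
    conv_lhs => rw [hh]
    rw [map_add, map_add, coeff_C_mul, coeff_X_pow, coeff_X_pow_mul', coeff_X_pow_mul', coeff_C,
      coeff_mk]
    by_cases hm : k ≤ m
    · rw [if_neg (by omega), if_pos (by omega), if_neg (by omega), if_pos hm,
        show m + B.e - (k + B.e) = m - k by omega, Nat.cast_sub hm]
      ring
    · rw [if_neg (show ¬ k + B.e ≤ m + B.e by omega), if_neg hm]
      by_cases hm0 : m = 0
      · subst hm0
        simp [he]
      · rw [if_neg (by omega), if_neg hm0]
        simp

theorem aeval_tangentForm :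
    MvPolynomial.aeval (applyFrame M B.param) B.tangentForm =
      B.h - C B.tangentSlope * X ^ B.e := by
  have h0 := sum_inv_smul_applyFrame M B.param 0
  have h1 := sum_inv_smul_applyFrame M B.param 1
  have h2 : MvPolynomial.aeval (applyFrame M B.param) B.tangentForm =
      ∑ k, ((M⁻¹ : GL (Fin 3) ℂ) : Matrix (Fin 3) (Fin 3) ℂ) 1 k • applyFrame M B.param k -
      B.tangentSlope •
        ∑ k, ((M⁻¹ : GL (Fin 3) ℂ) : Matrix (Fin 3) (Fin 3) ℂ) 0 k • applyFrame M B.param k := by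
    rw [tangentForm, map_sum, Finset.smul_sum, ← Finset.sum_sub_distrib]
    refine Finset.sum_congr rfl fun k _ => ?_
    rw [map_mul, MvPolynomial.aeval_X, MvPolynomial.aeval_C, ← Algebra.smul_def, sub_smul,
      mul_smul, tangentSlope]
  rw [h2, h0, h1, smul_eq_C_mul]
  rfl

section

variable {k : ℕ} {δ η : PowerSeries ℂ}

theorem inter_tangentForm (hη : constantCoeff η ≠ 0)
    (hh : B.h = C B.tangentSlope * X ^ B.e + X ^ (k + B.e) * η) :
    B.inter B.tangentForm = (((k + B.e : ℕ) : ℚ) : WithTop ℚ) := by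
  rw [inter_eq, aeval_tangentForm, hh, add_sub_cancel_left, ← toRat_natCast]
  congr 1
  have := min_order_eq (f := X ^ (k + B.e) * η) (b := η) rfl rfl (Or.inl hη)
  rwa [min_self] at this

theorem wSer_eq (hh : B.h = C B.tangentSlope * X ^ B.e + X ^ (k + B.e) * η)
    (hD : slope B.e B.h = C B.tangentSlope + X ^ k * δ) (v : Fin 3 → ℂ) :
    B.wSer (pullVec M v) = wRed B.e k δ η (B.coord v) := by
  rw [wSer, hD, hh, wRed]
  simp only [coord, Matrix.cons_val_zero, Matrix.cons_val_one, Matrix.cons_val, map_sub, map_mul]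
  ring

/-- The linear form of the moving tangent takes the value `W_P` at `P`. On the reflected vector it
gives `(1 - 1 - 1) W_A W_B W_S`, the input that `inf_order_cross` needs. -/
theorem contribution_eq_redOrder (hh : B.h = C B.tangentSlope * X ^ B.e + X ^ (k + B.e) * η)
    (hD : slope B.e B.h = C B.tangentSlope + X ^ k * δ) (s : Fin 3 → ℂ) :
    B.contribution s =
      toRat (redOrder B.e k δ η (B.coord vecI) (B.coord vecJ) (B.coord s)) := by
  rw [contribution_eq]
  congr 1
  have hw : ∀ v : Fin 3 → ℂ, C (pullVec M v 1) - C B.tangentSlope * C (pullVec M v 0) -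
      X ^ (k + B.e) * η * C (pullVec M v 2) -
      X ^ k * δ * (C (pullVec M v 0) - X ^ B.e * C (pullVec M v 2)) =
      wRed B.e k δ η (B.coord v) := by
    intro v
    rw [wRed]
    simp only [coord, Matrix.cons_val_zero, Matrix.cons_val_one, Matrix.cons_val, map_sub, map_mul]
    ring
  have hr : B.qSer s 0 - X ^ B.e * B.qSer s 2 =
      rRed B.e k δ η (B.coord vecI) (B.coord vecJ) (B.coord s) := by
    rw [qSer, qSer, wSer_eq B hh hD, wSer_eq B hh hD, wSer_eq B hh hD, rRed, xRed, xRed, xRed]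
    simp only [coord, Matrix.cons_val_zero, Matrix.cons_val]
    ring
  rw [redOrder, ← hr, param]
  refine inf_order_cross B.e B.h (X ^ k * δ) _ B.tangentSlope _ ?_
  have hh' : B.h - C B.tangentSlope * X ^ B.e = X ^ (k + B.e) * η := by
    rw [hh]
    ring
  rw [hh']
  simp only [qSer, wSer_eq B hh hD]
  linear_combination wRed B.e k δ η (B.coord vecI) * wRed B.e k δ η (B.coord vecJ) * hw s -
    wRed B.e k δ η (B.coord s) * wRed B.e k δ η (B.coord vecI) * hw vecJ -
    wRed B.e k δ η (B.coord s) * wRed B.e k δ η (B.coord vecJ) * hw vecI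

end

end Branch

/-! ### Truncated orders, osculating curves and the first characteristic exponent -/

theorem order_congr {f g : PowerSeries ℂ} (h : ∀ m, coeff m f = 0 ↔ coeff m g = 0) :
    f.order = g.order := by
  refine ENat.eq_of_forall_natCast_le_iff fun n => ?_
  simp only [le_order_iff_X_pow_dvd, X_pow_dvd_iff, h]

theorem min_order_congr {f g r : PowerSeries ℂ} {b : ℂ} {N : ℕ} (hb : b ≠ 0)
    (h : f = C b * g + X ^ N * r) : min f.order N = min g.order N := by
  refine ENat.eq_of_forall_natCast_le_iff fun n => ?_
  simp only [le_min_iff, le_order_iff_X_pow_dvd, Nat.cast_le]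
  refine and_congr_left fun hn => ?_
  have hN : X ^ n ∣ X ^ N * r := (pow_dvd_pow X hn).mul_right r
  rw [h, dvd_add_left hN]
  refine ⟨fun hg => ?_, fun hg => hg.mul_left _⟩
  have : g = C b⁻¹ * (C b * g) := by
    rw [← mul_assoc, ← map_mul, inv_mul_cancel₀ hb, map_one, one_mul]
  rw [this]
  exact hg.mul_left _

/-- Second order expansion of a polynomial along `p₀ + x p₁ + u p₂`, where `x = t ^ e` and `u` has
order at least `2 e`. -/
theorem exists_aeval_expansion (e : ℕ) (η : PowerSeries ℂ) (p₀ p₁ p₂ : Fin 3 → ℂ)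
    (G : MvPolynomial (Fin 3) ℂ) :
    ∃ (c : ℂ) (r : PowerSeries ℂ),
      MvPolynomial.aeval
        (fun k => C (p₀ k) + X ^ e * C (p₁ k) + X ^ (2 * e) * η * C (p₂ k)) G =
      C (MvPolynomial.eval p₀ G) +
        X ^ e * C (∑ j, MvPolynomial.eval p₀ (MvPolynomial.pderiv j G) * p₁ j) +
        X ^ (2 * e) * η * C (∑ j, MvPolynomial.eval p₀ (MvPolynomial.pderiv j G) * p₂ j) +
        X ^ (2 * e) * C c + X ^ (3 * e) * r := by
  induction G using MvPolynomial.induction_on with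
  | C a =>
    refine ⟨0, 0, ?_⟩
    simp
  | add p q hp hq =>
    obtain ⟨c, r, h⟩ := hp
    obtain ⟨c', r', h'⟩ := hq
    refine ⟨c + c', r + r', ?_⟩
    rw [map_add, h, h']
    simp only [map_add, add_mul, Finset.sum_add_distrib]
    ring
  | mul_X p i hp =>
    obtain ⟨c, r, h⟩ := hp
    have hd : ∀ (w : Fin 3 → ℂ),
        ∑ j, MvPolynomial.eval p₀ (MvPolynomial.pderiv j (p * MvPolynomial.X i)) * w j =
        (∑ j, MvPolynomial.eval p₀ (MvPolynomial.pderiv j p) * w j) * p₀ i +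
          MvPolynomial.eval p₀ p * w i := by
      intro w
      simp only [Derivation.leibniz, MvPolynomial.pderiv_X, smul_eq_mul, map_add, map_mul,
        MvPolynomial.eval_X, add_mul, Finset.sum_add_distrib, Finset.sum_mul]
      rw [add_comm]
      congr 1
      · exact Finset.sum_congr rfl fun j _ => by ring
      · rw [Finset.sum_eq_single i]
        · simp
        · intro j _ hj
          simp [hj.symm]
        · simp
    rw [map_mul, h, MvPolynomial.aeval_X]
    simp only [hd, map_mul, map_add, MvPolynomial.eval_X]
    set s₁ := ∑ j, MvPolynomial.eval p₀ (MvPolynomial.pderiv j p) * p₁ j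
    set s₂ := ∑ j, MvPolynomial.eval p₀ (MvPolynomial.pderiv j p) * p₂ j
    -- At `t^(2e)`, besides the term linear in `η`, only constants appear, because products
    -- involving `η` and a further positive power of `t^e` go into the remainder.
    refine ⟨s₁ * p₁ i + c * p₀ i,
      r * (C (p₀ i) + X ^ e * C (p₁ i) + X ^ (2 * e) * η * C (p₂ i)) +
        C s₁ * η * C (p₂ i) + η * C s₂ * C (p₁ i) + C c * C (p₁ i) +
        X ^ e * η * η * C s₂ * C (p₂ i) + X ^ e * η * C c * C (p₂ i), ?_⟩
    simp only [map_add, map_mul]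
    ring

/-- Only the exponent capped at `3e` matters, so quantities that agree below `3e` give the same
formula. -/
theorem natCast_eq_mul_one_add_min {e h : ℕ} (he : 0 < e) {q : ℕ∞}
    (hq : (h : ℕ∞) = e + min q (3 * e : ℕ)) {β : WithTop ℚ} (hβ : (e : WithTop ℚ) * β = toRat q) :
    ((h : ℚ) : WithTop ℚ) = (e : WithTop ℚ) * (1 + min β 3) := by
  have he' : (e : ℚ) ≠ 0 := Nat.cast_ne_zero.mpr he.ne'
  have heq : (e : WithTop ℚ) = ((e : ℚ) : WithTop ℚ) := rfl
  have h3 : (3 : WithTop ℚ) = ((3 : ℚ) : WithTop ℚ) := rfl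
  have h1 : (1 : WithTop ℚ) = ((1 : ℚ) : WithTop ℚ) := rfl
  induction q using ENat.recTopCoe with
  | top =>
    have hβ' : β = ⊤ := by
      induction β using WithTop.recTopCoe with
      | top => rfl
      | coe b =>
        rw [heq, ← WithTop.coe_mul] at hβ
        exact absurd hβ (WithTop.coe_ne_top)
    rw [min_eq_right le_top] at hq
    have hq' : h = e + 3 * e := by exact_mod_cast hq
    rw [hβ', min_eq_right le_top, heq, h1, h3, ← WithTop.coe_add, ← WithTop.coe_mul, WithTop.coe_inj, hq']
    push_cast
    ring
  | coe n =>
    induction β using WithTop.recTopCoe with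
    | top =>
      rw [heq, WithTop.mul_top (by simpa using he')] at hβ
      exact absurd hβ.symm (WithTop.coe_ne_top)
    | coe b =>
      rw [heq, ← WithTop.coe_mul, toRat_natCast, WithTop.coe_inj] at hβ
      have hq' : h = e + min n (3 * e) := by
        rw [← (Nat.mono_cast (α := ℕ∞)).map_min] at hq
        exact_mod_cast hq
      rw [heq, h1, h3, ← WithTop.coe_min, ← WithTop.coe_add, ← WithTop.coe_mul, WithTop.coe_inj,
        hq', Nat.cast_add, Nat.cast_min, ← hβ, mul_add, mul_one,
        mul_min_of_nonneg _ _ (Nat.cast_nonneg e)]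
      push_cast
      congr 2
      ring

namespace Branch

variable {F : MvPolynomial (Fin 3) ℂ} {M : GL (Fin 3) ℂ} (B : Branch F M)

section

variable {δ η : PowerSeries ℂ}

/-- The coefficients of `δ - 2η` are `(m/e) η_m`: only the constant one is lost. -/
theorem order_slope_sub (hδ : ∀ m, coeff m δ = ((m + B.e + B.e : ℂ) / B.e) * coeff m η) :
    (δ - 2 * η).order = (η - C (constantCoeff η)).order := by
  have he : (B.e : ℂ) ≠ 0 := Nat.cast_ne_zero.mpr B.e_pos.ne'
  refine order_congr fun m => ?_
  have h2 : (2 : PowerSeries ℂ) * η = C 2 * η := rfl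
  have h1 : coeff m (δ - 2 * η) = (m / B.e : ℂ) * coeff m η := by
    rw [map_sub, hδ, h2, coeff_C_mul]
    field_simp
    ring
  rw [h1, map_sub, coeff_C]
  by_cases hm : m = 0
  · subst hm
    simp
  · rw [if_neg hm, sub_zero, mul_eq_zero, or_iff_right]
    exact div_ne_zero (Nat.cast_ne_zero.mpr hm) he

theorem applyFrame_param (hh : B.h = C B.tangentSlope * X ^ B.e + X ^ (2 * B.e) * η) :
    applyFrame M B.param = fun k =>
      C ((M : Matrix (Fin 3) (Fin 3) ℂ).mulVec ![0, 0, 1] k) +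
      X ^ B.e * C ((M : Matrix (Fin 3) (Fin 3) ℂ).mulVec ![1, B.tangentSlope, 0] k) +
      X ^ (2 * B.e) * η * C ((M : Matrix (Fin 3) (Fin 3) ℂ).mulVec ![0, 1, 0] k) := by
  ext1 k
  simp only [applyFrame, param, Fin.sum_univ_three, Matrix.mulVec, dotProduct, smul_eq_C_mul,
    Matrix.cons_val_zero, Matrix.cons_val_one, Matrix.cons_val, map_add, map_mul, map_zero, map_one,
    hh]
  ring

theorem mulVec_eq_combination (v : Fin 3 → ℂ) :
    v = B.coord v 2 • (M : Matrix (Fin 3) (Fin 3) ℂ).mulVec ![0, 0, 1] +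
      B.coord v 0 • (M : Matrix (Fin 3) (Fin 3) ℂ).mulVec ![1, B.tangentSlope, 0] +
      B.coord v 1 • (M : Matrix (Fin 3) (Fin 3) ℂ).mulVec ![0, 1, 0] := by
  rw [← Matrix.mulVec_smul, ← Matrix.mulVec_smul, ← Matrix.mulVec_smul, ← Matrix.mulVec_add,
    ← Matrix.mulVec_add]
  conv_lhs => rw [← mulVec_pullVec M v]
  congr 1
  ext i
  fin_cases i <;> simp [coord]
  ring

theorem exists_eval_pderiv_ne_zero {G : MvPolynomial (Fin 3) ℂ} {n : ℕ} (hG : G.IsHomogeneous n)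
    (hs : IsSmoothAt G (frameCenter M)) :
    MvPolynomial.eval ((M : Matrix (Fin 3) (Fin 3) ℂ).mulVec ![0, 0, 1]) G = 0 ∧
    ∃ j, MvPolynomial.eval ((M : Matrix (Fin 3) (Fin 3) ℂ).mulVec ![0, 0, 1])
      (MvPolynomial.pderiv j G) ≠ 0 := by
  obtain ⟨h0, j, hj⟩ := hs
  refine ⟨(mk_mem_zeroLocus hG _ _).mp h0, j, fun h => hj ?_⟩
  exact (mk_mem_zeroLocus hG.pderiv _ _).mpr h

/-- Contact above `2e` forces the `t^e` coefficient and the constant at `t^(2e)` in the expansion of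
`G` to vanish. What is left is `b t^(2e) (η - η(0))` modulo `t^(3e)`, with `b ≠ 0` by smoothness. -/
theorem min_order_of_isOsculating
    (hh : B.h = C B.tangentSlope * X ^ B.e + X ^ (2 * B.e) * η)
    {G : MvPolynomial (Fin 3) ℂ} (hG : B.IsOsculating G) :
    min (MvPolynomial.aeval (applyFrame M B.param) G).order (3 * B.e : ℕ) =
      min (2 * B.e + (η - C (constantCoeff η)).order) (3 * B.e : ℕ) := by
  obtain ⟨⟨n, hn⟩, hs, hi⟩ := hG
  have he := B.e_pos
  have hord : ∀ m ≤ 2 * B.e, coeff m (MvPolynomial.aeval (applyFrame M B.param) G) = 0 := by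
    intro m hm
    apply coeff_of_lt_order
    rw [inter_eq] at hi
    by_contra hle
    obtain ⟨l, hl⟩ := ENat.ne_top_iff_exists.mp
      (ne_top_of_le_ne_top (ENat.natCast_ne_top m) (not_lt.mp hle))
    rw [← hl] at hi hle
    rw [toRat_natCast] at hi
    have h2 : (2 : WithTop ℚ) * (B.e : WithTop ℚ) = (((2 * B.e : ℕ) : ℚ) : WithTop ℚ) := by
      push_cast
      rfl
    rw [h2, WithTop.coe_lt_coe, Nat.cast_lt] at hi
    have : l ≤ m := by exact_mod_cast not_lt.mp hle
    omega
  obtain ⟨c, r, hr⟩ := exists_aeval_expansion B.e η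
    ((M : Matrix (Fin 3) (Fin 3) ℂ).mulVec ![0, 0, 1])
    ((M : Matrix (Fin 3) (Fin 3) ℂ).mulVec ![1, B.tangentSlope, 0])
    ((M : Matrix (Fin 3) (Fin 3) ℂ).mulVec ![0, 1, 0]) G
  obtain ⟨h0, j, hj⟩ := exists_eval_pderiv_ne_zero hn hs
  rw [← applyFrame_param B hh, h0, map_zero, zero_add] at hr
  set p₀ := (M : Matrix (Fin 3) (Fin 3) ℂ).mulVec ![0, 0, 1] with hp₀
  set p₁ := (M : Matrix (Fin 3) (Fin 3) ℂ).mulVec ![1, B.tangentSlope, 0] with hp₁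
  set p₂ := (M : Matrix (Fin 3) (Fin 3) ℂ).mulVec ![0, 1, 0] with hp₂
  set s₁ := ∑ j, MvPolynomial.eval p₀ (MvPolynomial.pderiv j G) * p₁ j with hs₁
  set b := ∑ j, MvPolynomial.eval p₀ (MvPolynomial.pderiv j G) * p₂ j with hb
  have hs₁0 : s₁ = 0 := by
    have := hord B.e (by omega)
    rw [hr] at this
    simpa [coeff_X_pow_mul', mul_assoc, show ¬ 2 * B.e ≤ B.e by omega,
      show B.e ≠ 2 * B.e by omega,       show ¬ 3 * B.e ≤ B.e by omega] using this
  have hc : c = -(b * constantCoeff η) := by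
    have := hord (2 * B.e) le_rfl
    rw [hr, hs₁0, map_zero, mul_zero, zero_add] at this
    simp [coeff_X_pow_mul', mul_assoc, show ¬ 3 * B.e ≤ 2 * B.e by omega] at this
    linear_combination this
  -- If `b = 0`, the gradient of `G` kills the tangent direction and `p₂`. Euler's relation makes it
  -- kill `p₀` too, so it vanishes, against smoothness.
  have hb0 : b ≠ 0 := by
    intro hb0
    have heuler : ∑ j, MvPolynomial.eval p₀ (MvPolynomial.pderiv j G) * p₀ j = 0 := by
      have := congrArg (MvPolynomial.eval p₀) hn.sum_X_mul_pderiv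
      rw [map_sum, map_nsmul, h0, smul_zero] at this
      rw [← this]
      refine Finset.sum_congr rfl fun j _ => ?_
      rw [map_mul, MvPolynomial.eval_X, mul_comm]
    have hall : ∀ v : Fin 3 → ℂ,
        ∑ j, MvPolynomial.eval p₀ (MvPolynomial.pderiv j G) * v j = 0 := by
      intro v
      rw [B.mulVec_eq_combination v, ← hp₀, ← hp₁, ← hp₂]
      simp only [Pi.add_apply, Pi.smul_apply, smul_eq_mul]
      rw [hs₁] at hs₁0
      rw [hb] at hb0
      simp only [Fin.sum_univ_three] at hs₁0 hb0 heuler ⊢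
      linear_combination B.coord v 2 * heuler + B.coord v 0 * hs₁0 + B.coord v 1 * hb0
    apply hj
    simpa [Pi.single_apply] using hall (Pi.single j 1)
  rw [hs₁0, hc, map_zero, mul_zero, zero_add, map_neg, map_mul] at hr
  have hf : MvPolynomial.aeval (applyFrame M B.param) G =
      C b * (X ^ (2 * B.e) * (η - C (constantCoeff η))) + X ^ (3 * B.e) * r := by
    rw [hr]
    ring
  rw [min_order_congr hb0 hf, order_mul, order_X_pow]
  norm_cast

/-- The linear form that gives the `i`-th coordinate in the frame. -/
def coordForm (M : GL (Fin 3) ℂ) (i : Fin 3) : MvPolynomial (Fin 3) ℂ :=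
  ∑ k, MvPolynomial.C (((M⁻¹ : GL (Fin 3) ℂ) : Matrix (Fin 3) (Fin 3) ℂ) i k) * MvPolynomial.X k

theorem isHomogeneous_coordForm (i : Fin 3) : (coordForm M i).IsHomogeneous 1 := by
  refine MvPolynomial.IsHomogeneous.sum _ _ _ fun k _ => ?_
  exact (MvPolynomial.isHomogeneous_C _ _).mul (MvPolynomial.isHomogeneous_X _ _)

theorem aeval_coordForm {A : Type} [CommRing A] [Algebra ℂ A] (v : Fin 3 → A) (i : Fin 3) :
    MvPolynomial.aeval (applyFrame M v) (coordForm M i) = v i := by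
  rw [← sum_inv_smul_applyFrame M v i, coordForm, map_sum]
  refine Finset.sum_congr rfl fun k _ => ?_
  rw [map_mul, MvPolynomial.aeval_X, MvPolynomial.aeval_C, ← Algebra.smul_def]

theorem eval_coordForm (v : Fin 3 → ℂ) (i : Fin 3) :
    MvPolynomial.eval ((M : Matrix (Fin 3) (Fin 3) ℂ).mulVec v) (coordForm M i) = v i :=
  aeval_coordForm v i

/-- The conic `(y - a x) z = η(0) x²` in frame coordinates works: it pulls back to `t^(2e) (η -
η(0))`, and its gradient at the center is that of the tangent form. -/
theorem exists_isOsculating (hh : B.h = C B.tangentSlope * X ^ B.e + X ^ (2 * B.e) * η) :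
    ∃ G, B.IsOsculating G := by
  set c := constantCoeff η with hc
  have hG : (B.tangentForm * coordForm M 2 -
      MvPolynomial.C c * (coordForm M 0 * coordForm M 0)).IsHomogeneous 2 := by
    refine MvPolynomial.IsHomogeneous.sub
      (B.isHomogeneous_tangentForm.mul (isHomogeneous_coordForm 2)) ?_
    have := (MvPolynomial.isHomogeneous_C (Fin 3) c).mul
      ((isHomogeneous_coordForm (M := M) 0).mul (isHomogeneous_coordForm (M := M) 0))
    simpa using this
  refine ⟨_, ⟨2, hG⟩, ⟨?_, ?_⟩, ?_⟩
  · rw [frameCenter, mk_mem_zeroLocus hG]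
    simp [eval_tangentForm, eval_coordForm, coord_center]
  · obtain ⟨k, hk⟩ : ∃ k, MvPolynomial.pderiv k B.tangentForm ≠ 0 := by
      by_contra! h
      have h1 := B.isHomogeneous_tangentForm.sum_X_mul_pderiv
      simp only [h, mul_zero, Finset.sum_const_zero, one_smul] at h1
      have h2 := B.eval_tangentForm ((M : Matrix (Fin 3) (Fin 3) ℂ).mulVec ![0, 1, 0])
      rw [← h1] at h2
      simp [coord, pullVec_mulVec] at h2
    refine ⟨k, fun h => hk ?_⟩
    have h0 := (mk_mem_zeroLocus hG.pderiv _ _).mp h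
    have h1 : (MvPolynomial.pderiv k B.tangentForm).IsHomogeneous 0 :=
      B.isHomogeneous_tangentForm.pderiv
    rw [← MvPolynomial.totalDegree_zero_iff_isHomogeneous,
      MvPolynomial.totalDegree_eq_zero_iff_eq_C] at h1
    simp [Derivation.leibniz, eval_tangentForm, eval_coordForm, coord_center] at h0
    rw [h1] at h0
    rw [h1]
    simpa using h0
  · rw [inter_eq, map_sub, map_mul, map_mul, map_mul, aeval_coordForm, aeval_coordForm,
      aeval_tangentForm, hh, MvPolynomial.aeval_C]
    have h1 : (C B.tangentSlope * X ^ B.e + X ^ (2 * B.e) * η - C B.tangentSlope * X ^ B.e) *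
        B.param 2 - algebraMap ℂ (PowerSeries ℂ) c * (B.param 0 * B.param 0) =
        X ^ (2 * B.e) * (η - C c) := by
      change (C B.tangentSlope * X ^ B.e + X ^ (2 * B.e) * η - C B.tangentSlope * X ^ B.e) *
        1 - C c * (X ^ B.e * X ^ B.e) = _
      ring
    rw [h1]
    obtain ⟨r, hr⟩ : X ∣ η - C c := by
      rw [X_dvd_iff, map_sub, constantCoeff_C, hc, sub_self]
    have h2 : ((2 * B.e + 1 : ℕ) : ℕ∞) ≤ (X ^ (2 * B.e) * (η - C c)).order := by
      rw [le_order_iff_X_pow_dvd, hr, pow_succ]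
      exact mul_dvd_mul_left _ (Dvd.intro _ rfl)
    have h3 : (2 : WithTop ℚ) * (B.e : WithTop ℚ) = (((2 * B.e : ℕ) : ℚ) : WithTop ℚ) := by
      push_cast
      rfl
    rw [h3]
    generalize (X ^ (2 * B.e) * (η - C c)).order = q at h2 ⊢
    induction q using ENat.recTopCoe with
    | top => exact WithTop.coe_lt_top _
    | coe n =>
      rw [toRat_natCast, WithTop.coe_lt_coe, Nat.cast_lt]
      exact Nat.cast_le.mp h2

/-- No integer strictly between `2e` and `3e` is a multiple of `e`, so in that range the first
nonconstant term of `η` gives the first exponent not divisible by `e`. Past `3e` the cap hides any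
difference. -/
theorem exists_firstCharExp (hh : B.h = C B.tangentSlope * X ^ B.e + X ^ (2 * B.e) * η) :
    ∃ q : ℕ∞, B.firstCharExp = toRat q ∧
      min q (3 * B.e : ℕ) = min (2 * B.e + (η - C (constantCoeff η)).order) (3 * B.e : ℕ) := by
  classical
  have he := B.e_pos
  have hcoeff : ∀ n, ¬ B.e ∣ n → coeff n B.h =
      if 2 * B.e ≤ n then coeff (n - 2 * B.e) (η - C (constantCoeff η)) else 0 := by
    intro n hn
    rw [hh, map_add, coeff_C_mul, coeff_X_pow, if_neg (fun h => hn (by rw [h])), mul_zero, zero_add,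
      coeff_X_pow_mul']
    split_ifs with h
    · rw [map_sub, coeff_C, if_neg, sub_zero]
      intro h0
      exact hn ⟨2, by omega⟩
    · rfl
  have hle : ∀ n, coeff n B.h ≠ 0 → ¬ B.e ∣ n →
      2 * B.e + (η - C (constantCoeff η)).order ≤ (n : ℕ∞) := by
    intro n hn hd
    rw [hcoeff n hd] at hn
    split_ifs at hn with h
    · have := order_le _ hn
      calc 2 * (B.e : ℕ∞) + (η - C (constantCoeff η)).order
          ≤ 2 * (B.e : ℕ∞) + ((n - 2 * B.e : ℕ) : ℕ∞) := by gcongr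
        _ = (n : ℕ∞) := by
          norm_cast
          omega
    · exact absurd rfl hn
  have hex : 2 * B.e + (η - C (constantCoeff η)).order < ((3 * B.e : ℕ) : ℕ∞) →
      ∃ n : ℕ, (n : ℕ∞) = 2 * B.e + (η - C (constantCoeff η)).order ∧
        coeff n B.h ≠ 0 ∧ ¬ B.e ∣ n := by
    intro h
    have hne : (η - C (constantCoeff η)).order ≠ ⊤ := by
      intro h1
      rw [h1, add_top] at h
      exact absurd h (not_lt.mpr le_top)
    obtain ⟨j, hj⟩ := ENat.ne_top_iff_exists.mp hne
    have hj' := (order_eq_nat.mp hj.symm).1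
    have hj0 : j ≠ 0 := by
      rintro rfl
      simp at hj'
    rw [← hj] at h ⊢
    have hje : j < B.e := by
      have : 2 * B.e + j < 3 * B.e := by exact_mod_cast h
      omega
    have hnd : ¬ B.e ∣ 2 * B.e + j := by
      rw [Nat.dvd_add_right (Dvd.intro_left 2 rfl)]
      exact Nat.not_dvd_of_pos_of_lt (Nat.pos_of_ne_zero hj0) hje
    refine ⟨2 * B.e + j, by push_cast; rfl, ?_, hnd⟩
    rw [hcoeff _ hnd, if_pos (by omega), Nat.add_sub_cancel_left]
    exact hj'
  unfold firstCharExp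
  split_ifs with H
  · refine ⟨(Nat.find H : ℕ), rfl, ?_⟩
    have h1 := hle _ (Nat.find_spec H).1 (Nat.find_spec H).2
    rcases lt_or_ge (2 * B.e + (η - C (constantCoeff η)).order) ((3 * B.e : ℕ) : ℕ∞) with h | h
    · obtain ⟨n, hn, hn1⟩ := hex h
      have h2 : ((Nat.find H : ℕ) : ℕ∞) ≤ n := Nat.cast_le.mpr (Nat.find_min' H hn1)
      rw [hn] at h2
      rw [le_antisymm h2 h1]
    · rw [min_eq_right h, min_eq_right (h.trans h1)]
  · refine ⟨⊤, rfl, ?_⟩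
    rcases lt_or_ge (2 * B.e + (η - C (constantCoeff η)).order) ((3 * B.e : ℕ) : ℕ∞) with h | h
    · obtain ⟨n, -, hn1⟩ := hex h
      exact absurd ⟨n, hn1⟩ H
    · rw [min_eq_right h, min_eq_right le_top]

end

end Branch

/-! ### Incidence of points and finiteness of the local order -/

theorem left_mem_lineThrough (P Q : P2) : P ∈ lineThrough P Q :=
  show P.submodule ≤ P.submodule ⊔ Q.submodule from le_sup_left

theorem right_mem_lineThrough (P Q : P2) : Q ∈ lineThrough P Q :=
  show Q.submodule ≤ P.submodule ⊔ Q.submodule from le_sup_right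

theorem ptI_ne_ptJ : ptI ≠ ptJ := by
  intro h
  rw [ptI, ptJ, Projectivization.mk_eq_mk_iff'] at h
  obtain ⟨c, hc⟩ := h
  have h0 := congrFun hc 0
  have h1 := congrFun hc 1
  simp only [vecI, vecJ, Pi.smul_apply, smul_eq_mul, Matrix.cons_val_zero, Matrix.cons_val_one,
    mul_one, mul_neg] at h0 h1
  rw [h0, one_mul] at h1
  have : (2 : ℂ) * Complex.I = 0 := by linear_combination -h1
  simp at this

theorem mem_unique_of_ncard_inter_eq_one {α : Type*} {T : Set α} {a b c : α}
    (h : (T ∩ {a, b, c}).ncard = 1) (hab : a ≠ b) (hac : a ≠ c) (hbc : b ≠ c) :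
    (a ∈ T ∧ b ∉ T ∧ c ∉ T) ∨ (a ∉ T ∧ b ∈ T ∧ c ∉ T) ∨ (a ∉ T ∧ b ∉ T ∧ c ∈ T) := by
  obtain ⟨p, hp⟩ := Set.ncard_eq_one.mp h
  have key : ∀ q ∈ ({a, b, c} : Set α), q ∈ T ↔ q = p := fun q hq => by
    rw [← Set.mem_singleton_iff, ← hp, Set.mem_inter_iff, and_iff_left hq]
  have ha := key a (by simp)
  have hb := key b (by simp)
  have hc := key c (by simp)
  have hp' : p ∈ T ∩ {a, b, c} := hp ▸ Set.mem_singleton p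
  rcases hp'.2 with rfl | rfl | rfl
  · exact Or.inl ⟨hp'.1, fun h => hab (hb.mp h).symm, fun h => hac (hc.mp h).symm⟩
  · exact Or.inr (Or.inl ⟨fun h => hab (ha.mp h), hp'.1, fun h => hbc (hc.mp h).symm⟩)
  · exact Or.inr (Or.inr ⟨fun h => hac (ha.mp h), fun h => hbc (hb.mp h), hp'.1⟩)

theorem wRed_ne_zero {e k : ℕ} {δ η : PowerSeries ℂ} {P : Fin 3 → ℂ} (he : e ≠ 0) (hk : k ≠ 0)
    (hδ : constantCoeff δ ≠ 0) (hδη : constantCoeff δ - constantCoeff η ≠ 0)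
    (hP : P 1 = 0 → P 0 = 0 → P 2 ≠ 0) : wRed e k δ η P ≠ 0 := by
  by_cases h1 : P 1 = 0
  · by_cases h0 : P 0 = 0
    · rw [wRed_of_center h1 h0]
      refine mul_ne_zero (pow_ne_zero _ X_ne_zero) (mul_ne_zero ?_ ?_)
      · exact fun h => hδη (by rw [← map_sub, h, map_zero])
      · exact fun h => hP h1 h0 (C_injective (by rw [h, map_zero]))
    · rw [wRed_of_mem h1]
      refine mul_ne_zero (pow_ne_zero _ X_ne_zero) fun h => ?_
      have := constantCoeff_wRedDiv (δ := δ) (η := η) (P := P) he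
      rw [h, map_zero, eq_comm, neg_eq_zero] at this
      exact mul_ne_zero hδ h0 this
  · intro h
    have := constantCoeff_wRed (e := e) (δ := δ) (η := η) (P := P) hk
    rw [h, map_zero] at this
    exact h1 this.symm

/-- The triple product alone bounds the order, since power series over a field form a domain. -/
theorem redOrder_ne_top {e k : ℕ} {δ η : PowerSeries ℂ} {A B S : Fin 3 → ℂ}
    (hA : wRed e k δ η A ≠ 0) (hB : wRed e k δ η B ≠ 0) (hS : wRed e k δ η S ≠ 0) :
    redOrder e k δ η A B S ≠ ⊤ := by
  refine ne_top_of_le_ne_top ?_ (min_le_right _ _)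
  rw [Ne, order_eq_top]
  exact mul_ne_zero (mul_ne_zero hA hB) hS

end Caustic

end

/-! ### Assembly of the cases -/

open Caustic in
theorem mainTheorem5 (d : ℕ) (hd : 2 ≤ d) (F : MvPolynomial (Fin 3) ℂ)
    (hF : F.IsHomogeneous d) (hirr : Irreducible F)
    (s : Fin 3 → ℂ) (hs : s ≠ 0) (S : Caustic.P2) (hS : Projectivization.mk ℂ s hs = S)
    (hSI : S ≠ Caustic.ptI) (hSJ : S ≠ Caustic.ptJ)
    (m₁ : Caustic.P2) (M : GL (Fin 3) ℂ) (hM : Caustic.frameCenter M = m₁)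
    (B : Caustic.Branch F M) (T : Set Caustic.P2) (hT : B.tangentLine = T)
    (I J : Caustic.P2) (hI : I = Caustic.ptI) (hJ : J = Caustic.ptJ) :
    ∃ i h : ℕ,
      -- the intersection number with the tangent line and the local contribution are finite
      B.inter B.tangentForm = ((i : ℚ) : WithTop ℚ) ∧
      B.contribution s = ((h : ℚ) : WithTop ℚ) ∧
      -- 1
      (I ∉ T → J ∉ T → S ∉ T → h = 0) ∧
      -- 2
      ((T ∩ {I, J, S}).ncard = 1 → m₁ ∉ ({I, J, S} : Set Caustic.P2) → h = 0) ∧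
      -- 3
      ((T ∩ {I, J, S}).ncard = 1 → m₁ ∈ ({I, J, S} : Set Caustic.P2) → h = B.e) ∧
      -- 4
      (T = Caustic.lineThrough I S → J ∉ T → m₁ ∉ ({I, S} : Set Caustic.P2) →
        (h : ℤ) = i + min ((i : ℤ) - 2 * B.e) 0) ∧
      (T = Caustic.lineThrough J S → I ∉ T → m₁ ∉ ({J, S} : Set Caustic.P2) →
        (h : ℤ) = i + min ((i : ℤ) - 2 * B.e) 0) ∧
      -- 5
      (T = Caustic.lineThrough I S → J ∉ T → m₁ ∈ ({I, S} : Set Caustic.P2) → h = i) ∧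
      (T = Caustic.lineThrough J S → I ∉ T → m₁ ∈ ({J, S} : Set Caustic.P2) → h = i) ∧
      -- 6
      (T = Caustic.lineThrough I J → S ∉ T → m₁ ∉ ({I, J} : Set Caustic.P2) →
        (h : ℤ) = (i : ℤ) - B.e) ∧
      -- 7
      (T = Caustic.lineThrough I J → S ∉ T → m₁ ∈ ({I, J} : Set Caustic.P2) → h = i) ∧
      -- 8
      (I ∈ T → J ∈ T → S ∈ T → m₁ ∉ ({I, J, S} : Set Caustic.P2) →
        (h : ℤ) = 2 * i - 2 * B.e) ∧
      -- 9
      (I ∈ T → J ∈ T → S ∈ T → m₁ ∈ ({I, J} : Set Caustic.P2) →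
        (h : ℤ) = 2 * i - B.e) ∧
      -- 10
      (I ∈ T → J ∈ T → S ∈ T → m₁ = S → i ≠ 2 * B.e → (h : ℤ) = 2 * i - B.e) ∧
      -- 11
      (I ∈ T → J ∈ T → S ∈ T → m₁ = S → i = 2 * B.e →
        (∃ G, B.IsOsculating G) ∧
        (∀ G, B.IsOsculating G → ∀ β₁ : WithTop ℚ, (B.e : WithTop ℚ) * β₁ = B.inter G →
          ((h : ℚ) : WithTop ℚ) = (B.e : WithTop ℚ) * (1 + min β₁ 3)) ∧
        (∀ β₁ : WithTop ℚ, (B.e : WithTop ℚ) * β₁ = B.firstCharExp →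
          ((h : ℚ) : WithTop ℚ) = (B.e : WithTop ℚ) * (1 + min β₁ 3))) := by
  have hIJ : I ≠ J := by rw [hI, hJ]; exact ptI_ne_ptJ
  rw [← hI] at hSI
  rw [← hJ] at hSJ
  obtain ⟨k, δ, η, hk, hη, hδη, hh, hD⟩ := B.exists_normal_form (B.h_ne_tangent hd hF hirr)
  have he : B.e ≠ 0 := B.e_pos.ne'
  have heC : (B.e : ℂ) ≠ 0 := Nat.cast_ne_zero.mpr he
  have hkC : (k : ℂ) ≠ 0 := Nat.cast_ne_zero.mpr hk
  -- The source of all nonvanishing leading coefficients: `δ(0)`, `δ(0) - η(0)` and `2δ(0) - η(0)`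
  -- are positive rational multiples of `η(0)`.
  have hδ0 : B.e * PowerSeries.constantCoeff δ = (k + B.e) * PowerSeries.constantCoeff η := by
    have := hδη 0
    rw [PowerSeries.coeff_zero_eq_constantCoeff_apply,
      PowerSeries.coeff_zero_eq_constantCoeff_apply] at this
    rw [this]
    push_cast
    field_simp
    ring
  have hδ : PowerSeries.constantCoeff δ ≠ 0 := by
    intro h
    rw [h, mul_zero, eq_comm, mul_eq_zero] at hδ0
    have : ((k + B.e : ℕ) : ℂ) ≠ 0 := Nat.cast_ne_zero.mpr (by omega)
    push_cast at this
    exact hδ0.elim this hη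
  have hδ1 : PowerSeries.constantCoeff δ - PowerSeries.constantCoeff η ≠ 0 := by
    intro h
    exact mul_ne_zero hkC hη (by linear_combination (B.e : ℂ) * h - hδ0)
  have hδ2 : 2 * PowerSeries.constantCoeff δ - PowerSeries.constantCoeff η ≠ 0 := by
    intro h
    have h2 : ((2 * k + B.e : ℕ) : ℂ) ≠ 0 := Nat.cast_ne_zero.mpr (by omega)
    push_cast at h2
    exact mul_ne_zero h2 hη (by linear_combination (B.e : ℂ) * h - 2 * hδ0)
  have mI : I ∈ T ↔ B.coord vecI 1 = 0 := by
    rw [hI, ← hT]; exact B.mk_mem_tangentLine _ _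
  have mJ : J ∈ T ↔ B.coord vecJ 1 = 0 := by
    rw [hJ, ← hT]; exact B.mk_mem_tangentLine _ _
  have mS : S ∈ T ↔ B.coord s 1 = 0 := by
    rw [← hS, ← hT]; exact B.mk_mem_tangentLine _ _
  have cI : m₁ = I ↔ B.coord vecI 1 = 0 ∧ B.coord vecI 0 = 0 := by
    rw [hI, ← hM, eq_comm]; exact B.mk_eq_frameCenter_iff _ _
  have cJ : m₁ = J ↔ B.coord vecJ 1 = 0 ∧ B.coord vecJ 0 = 0 := by
    rw [hJ, ← hM, eq_comm]; exact B.mk_eq_frameCenter_iff _ _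
  have cS : m₁ = S ↔ B.coord s 1 = 0 ∧ B.coord s 0 = 0 := by
    rw [← hS, ← hM, eq_comm]; exact B.mk_eq_frameCenter_iff _ _
  have zI := B.coord_two_ne_zero vecI_ne_zero
  have zJ := B.coord_two_ne_zero vecJ_ne_zero
  have zS := B.coord_two_ne_zero hs
  have dIS := B.coord_det_ne_zero vecI_ne_zero hs (by rw [hS]; exact fun h => hSI (h.symm.trans hI.symm))
  have dJS := B.coord_det_ne_zero vecJ_ne_zero hs (by rw [hS]; exact fun h => hSJ (h.symm.trans hJ.symm))
  have hcon := B.contribution_eq_redOrder hh hD s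
  have hint := B.inter_tangentForm hη hh
  generalize hPA : B.coord vecI = PA at *
  generalize hPB : B.coord vecJ = PB at *
  generalize hPS : B.coord s = PS at *
  obtain ⟨h, hord⟩ := ENat.ne_top_iff_exists.mp (redOrder_ne_top
    (wRed_ne_zero he hk hδ hδ1 zI) (wRed_ne_zero he hk hδ hδ1 zJ) (wRed_ne_zero he hk hδ hδ1 zS))
  rw [← hord, toRat_natCast] at hcon
  have hcomm : redOrder B.e k δ η PB PA PS = h := by rw [hord, redOrder_comm]
  have hord := hord.symm
  have hval : ∀ {n : ℕ}, redOrder B.e k δ η PA PB PS = n → h = n := fun hn =>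
    Nat.cast_injective (hord.symm.trans hn)
  have hval' : ∀ {n : ℕ}, redOrder B.e k δ η PB PA PS = n → h = n := fun hn =>
    Nat.cast_injective (hcomm.symm.trans hn)
  simp only [Set.mem_insert_iff, Set.mem_singleton_iff, not_or]
  refine ⟨k + B.e, h, hint, hcon, ?_, ?_, ?_, ?_, ?_, ?_, ?_, ?_, ?_, ?_, ?_, ?_, ?_⟩
  · intro hA hB hS'
    rw [mI] at hA
    rw [mJ] at hB
    rw [mS] at hS'
    exact hval (redOrder_of_generic hk hA hB hS')
  · rintro hc ⟨h1, h2, h3⟩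
    rw [cI] at h1
    rw [cJ] at h2
    rw [cS] at h3
    have := mem_unique_of_ncard_inter_eq_one hc hIJ hSI.symm hSJ.symm
    rw [mI, mJ, mS] at this
    rcases this with ⟨hA, hB, hS'⟩ | ⟨hA, hB, hS'⟩ | ⟨hA, hB, hS'⟩
    · exact hval (redOrder_of_only_left he hk hA (fun h0 => h1 ⟨hA, h0⟩) hB hS')
    · exact hval' (redOrder_of_only_left he hk hB (fun h0 => h2 ⟨hB, h0⟩) hA hS')
    · exact hval (redOrder_of_only_source he hk hA hB hS' (fun h0 => h3 ⟨hS', h0⟩))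
  · intro hc hm
    rw [cI, cJ, cS] at hm
    have := mem_unique_of_ncard_inter_eq_one hc hIJ hSI.symm hSJ.symm
    rw [mI, mJ, mS] at this
    rcases this with ⟨hA, hB, hS'⟩ | ⟨hA, hB, hS'⟩ | ⟨hA, hB, hS'⟩
    · have h0 : PA 0 = 0 := hm.elim And.right (Or.rec (fun h => absurd h.1 hB) fun h => absurd h.1 hS')
      exact hval (redOrder_of_only_left_center hk hA h0 (zI hA h0) hB hS')
    · have h0 : PB 0 = 0 := hm.elim (fun h => absurd h.1 hA) (Or.rec And.right fun h => absurd h.1 hS')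
      exact hval' (redOrder_of_only_left_center hk hB h0 (zJ hB h0) hA hS')
    · have h0 : PS 0 = 0 := hm.elim (fun h => absurd h.1 hA) (Or.rec (fun h => absurd h.1 hB) And.right)
      exact hval (redOrder_of_only_source_center hk hA hB hS' h0 (zS hS' h0))
  · rintro hl hB ⟨h1, h2⟩
    have hA := mI.mp (hl ▸ left_mem_lineThrough I S)
    have hS' := mS.mp (hl ▸ right_mem_lineThrough I S)
    rw [mJ] at hB
    have := hval (redOrder_of_left_source he hk hη hδ hA hS' hB (dIS hA hS')
      (fun h0 => h1 (cI.mpr ⟨hA, h0⟩)) (fun h0 => h2 (cS.mpr ⟨hS', h0⟩)))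
    push_cast
    omega
  · rintro hl hA ⟨h1, h2⟩
    have hB := mJ.mp (hl ▸ left_mem_lineThrough J S)
    have hS' := mS.mp (hl ▸ right_mem_lineThrough J S)
    rw [mI] at hA
    have := hval' (redOrder_of_left_source he hk hη hδ hB hS' hA (dJS hB hS')
      (fun h0 => h1 (cJ.mpr ⟨hB, h0⟩)) (fun h0 => h2 (cS.mpr ⟨hS', h0⟩)))
    push_cast
    omega
  · intro hl hB hm
    have hA := mI.mp (hl ▸ left_mem_lineThrough I S)
    have hS' := mS.mp (hl ▸ right_mem_lineThrough I S)
    rw [mJ] at hB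
    rw [cI, cS] at hm
    exact hval (redOrder_of_left_source_center hk hη hA hS' hB (dIS hA hS') (hm.imp And.right And.right))
  · intro hl hA hm
    have hB := mJ.mp (hl ▸ left_mem_lineThrough J S)
    have hS' := mS.mp (hl ▸ right_mem_lineThrough J S)
    rw [mI] at hA
    rw [cJ, cS] at hm
    exact hval' (redOrder_of_left_source_center hk hη hB hS' hA (dJS hB hS') (hm.imp And.right And.right))
  · rintro hl hS' ⟨h1, h2⟩
    have hA := mI.mp (hl ▸ left_mem_lineThrough I J)
    have hB := mJ.mp (hl ▸ right_mem_lineThrough I J)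
    rw [mS] at hS'
    have := hval (redOrder_of_left_right he hk hδ hA hB hS'
      (fun h0 => h1 (cI.mpr ⟨hA, h0⟩)) (fun h0 => h2 (cJ.mpr ⟨hB, h0⟩)))
    push_cast
    omega
  · intro hl hS' hm
    have hA := mI.mp (hl ▸ left_mem_lineThrough I J)
    have hB := mJ.mp (hl ▸ right_mem_lineThrough I J)
    rw [mS] at hS'
    rcases hm with hm | hm
    · have h0 := (cI.mp hm).2
      exact hval (redOrder_of_left_center_right he hk hδ2 hA hB hS' h0 (zI hA h0)
        (fun h1 => hIJ (hm.symm.trans (cJ.mpr ⟨hB, h1⟩))))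
    · have h0 := (cJ.mp hm).2
      exact hval' (redOrder_of_left_center_right he hk hδ2 hB hA hS' h0 (zJ hB h0)
        (fun h1 => hIJ ((cI.mpr ⟨hA, h1⟩).symm.trans hm)))
  · rintro hA hB hS' ⟨h1, h2, h3⟩
    rw [mI] at hA
    rw [mJ] at hB
    rw [mS] at hS'
    have := hval (redOrder_of_all he hδ hA hB hS' (fun h0 => h1 (cI.mpr ⟨hA, h0⟩))
      (fun h0 => h2 (cJ.mpr ⟨hB, h0⟩)) (fun h0 => h3 (cS.mpr ⟨hS', h0⟩)))
    push_cast
    omega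
  · intro hA hB hS' hm
    rw [mI] at hA
    rw [mJ] at hB
    rw [mS] at hS'
    have : h = 2 * k + B.e := by
      rcases hm with hm | hm
      · have h0 := (cI.mp hm).2
        exact hval (redOrder_of_all_left_center he hδ hA hB hS' h0 (zI hA h0)
          (fun h1 => hIJ (hm.symm.trans (cJ.mpr ⟨hB, h1⟩)))
          (fun h1 => hSI ((cS.mpr ⟨hS', h1⟩).symm.trans hm)))
      · have h0 := (cJ.mp hm).2
        exact hval' (redOrder_of_all_left_center he hδ hB hA hS' h0 (zJ hB h0)
          (fun h1 => hIJ ((cI.mpr ⟨hA, h1⟩).symm.trans hm))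
          (fun h1 => hSJ ((cS.mpr ⟨hS', h1⟩).symm.trans hm)))
    push_cast
    omega
  · intro hA hB hS' hm hi
    rw [mI] at hA
    rw [mJ] at hB
    rw [mS] at hS'
    have h0 := (cS.mp hm).2
    -- `e (δ(0) - 2η(0)) = (k - e) η(0)`, and `k ≠ e` because `ι ≠ 2e`.
    have hne : PowerSeries.constantCoeff δ - 2 * PowerSeries.constantCoeff η ≠ 0 := by
      intro h
      have h2 : (k : ℂ) - B.e ≠ 0 := sub_ne_zero.mpr (Nat.cast_injective.ne (by omega))
      exact mul_ne_zero h2 hη (by linear_combination (B.e : ℂ) * h - hδ0)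
    have := hval (redOrder_of_all_source_center he hδ hne hA hB hS'
      (fun h1 => hSI (hm.symm.trans (cI.mpr ⟨hA, h1⟩)))
      (fun h1 => hSJ (hm.symm.trans (cJ.mpr ⟨hB, h1⟩))) h0 (zS hS' h0))
    push_cast
    omega
  · intro hA hB hS' hm hi
    rw [mI] at hA
    rw [mJ] at hB
    rw [mS] at hS'
    have h0 := (cS.mp hm).2
    obtain rfl : k = B.e := by omega
    have hred := redOrder_of_all_source_center_inflection he hδ hδ1 hA hB hS'
      (fun h1 => hSI (hm.symm.trans (cI.mpr ⟨hA, h1⟩)))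
      (fun h1 => hSJ (hm.symm.trans (cJ.mpr ⟨hB, h1⟩))) h0 (zS hS' h0)
    rw [hord, B.order_slope_sub hδη] at hred
    rw [← two_mul] at hh
    -- The order `3e + min(q, e)` is rewritten as `e + min(2e + q, 3e)`, the shape in which both
    -- candidates for `e β₁` enter.
    have hh2 : (h : ℕ∞) = B.e + min (2 * B.e +
        (η - PowerSeries.C (PowerSeries.constantCoeff η)).order) (3 * B.e : ℕ) := by
      rw [hred]
      generalize (η - PowerSeries.C (PowerSeries.constantCoeff η)).order = q
      induction q using ENat.recTopCoe with
      | top =>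
        rw [add_top, min_eq_right le_top, min_eq_right le_top]
        norm_cast
        omega
      | coe n =>
        have h2 : 2 * (B.e : ℕ∞) + (n : ℕ∞) = ((2 * B.e + n : ℕ) : ℕ∞) := by push_cast; rfl
        rw [h2, ← (Nat.mono_cast (α := ℕ∞)).map_min, ← (Nat.mono_cast (α := ℕ∞)).map_min]
        norm_cast
        omega
    refine ⟨B.exists_isOsculating hh, fun G hG β hβ => ?_, fun β hβ => ?_⟩
    · rw [B.inter_eq] at hβ
      refine natCast_eq_mul_one_add_min B.e_pos ?_ hβ
      rw [B.min_order_of_isOsculating hh hG, hh2]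
    · obtain ⟨q, hq, hq2⟩ := B.exists_firstCharExp hh
      rw [hq] at hβ
      refine natCast_eq_mul_one_add_min B.e_pos ?_ hβ
      rw [hq2, hh2]
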